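/- **Theorem 3.1.** The Selberg class $\mathcal S$ is the set of functions $F$ with the following properties. 1. (Dirichlet series) $F(s)=\sum_{n\ge 1} a_n n^{-s}$ for $\Re s>1$, and $(s-1)^mF(s)$ extends to an entire function of finite order for some integer $m\ge 0$; the extension of $F$ is again denoted $F$. 2. (Ramanujan hypothesis) $a_n\ll_\delta n^{\delta}$ for every $\delta>0$. 3. (Functional equation) $F$ has at least one *admissible gamma factor*, that is, a function $\gamma(s)=\epsilon Q^s\prod_{i=1}^k\Gamma(w_is+\mu_i)$ with $k\ge 0$, $|\epsilon|=1$, $Q>0$, $w_i>0$ and $\Re\mu_i\ge 0$, such that $\Phi(s)=\gamma(s)F(s)$ satisfies $\Phi(s)=\overline{\Phi(1-\bar s)}$ as meromorphic functions. 4. (Euler product) $a_1=1$, and $\log F(s)=\sum_{n\ge1} b_n n^{-s}$ for $\Re s>1$, where $b_n=0$ unless $n$ is a positive power of a prime, and $b_n\ll n^{\theta}$ for some $\theta<1/2$. The degree of a gamma factor is $2\sum_{i=1}^k w_i$, and $\mathcal S(d)$ denotes the set of $F\in\mathcal S$ that have an admissible gamma factor of degree $d$. Then every $F\in\mathcal S$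 either is the constant function $1$ or has degree $d_F\ge 1$, in the sense that every admissible gamma factor of $F$ has degree at least $1$. In particular, $\mathcal S(d)=\emptyset$ for $0<d<1$. Moreover $\mathcal S(0)=\{1\}$. -/

import Mathlib

open Filter Topology Asymptotics

namespace SelbergDegree

/-- The data of a gamma factor `γ(s) = ε Q ^ s ∏ i, Γ(w i * s + μ i)`, with the constraints
`|ε| = 1`, `Q > 0`, `w i > 0`, `Re (μ i) ≥ 0`. The product may be empty (`k = 0`). -/
structure GammaFactor where
  k : ℕ
  ε : ℂ
  Q : ℝ
  w : Fin k → ℝ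
  μ : Fin k → ℂ
  norm_ε : ‖ε‖ = 1
  Q_pos : 0 < Q
  w_pos : ∀ i, 0 < w i
  re_μ_nonneg : ∀ i, 0 ≤ (μ i).re

/-- The value `γ(s) = ε Q ^ s ∏ i, Γ(w i * s + μ i)` (meaningful when `s` is not a pole). -/
noncomputable def GammaFactor.eval (γ : GammaFactor) (s : ℂ) : ℂ :=
  γ.ε * (γ.Q : ℂ) ^ s * ∏ i, Complex.Gamma ((γ.w i : ℂ) * s + γ.μ i)

/-- The poles of `γ`: the points `s` with `w i * s + μ i = -n` for some `i` and `n ≥ 0`. -/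
def GammaFactor.IsPole (γ : GammaFactor) (s : ℂ) : Prop :=
  ∃ (i : Fin γ.k) (n : ℕ), (γ.w i : ℂ) * s + γ.μ i = -(n : ℂ)

/-- The degree `2 ∑ i, w i` of a gamma factor. -/
noncomputable def GammaFactor.degree (γ : GammaFactor) : ℝ :=
  2 * ∑ i, γ.w i

/-- An entire function of finite order: `|G(s)| ≪ exp (|s| ^ ρ)` as `|s| → ∞`, for some `ρ`. -/
def IsEntireOfFiniteOrder (G : ℂ → ℂ) : Prop :=
  Differentiable ℂ G ∧
    ∃ ρ : ℝ, G =O[Bornology.cobounded ℂ] fun s : ℂ => Real.exp (‖s‖ ^ ρ)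

/-- Analyticity: `(s - 1) ^ m * F s` is entire of finite order for some `m ≥ 0`. Since `F` is
a total function, the product is only read off away from `s = 1`; at `s = 1` itself
`F` is either regular (with its correct value) or has a genuine pole, where the value that Lean
stores is irrelevant. -/
def HasAnalyticity (F : ℂ → ℂ) : Prop :=
  (∃ (m : ℕ) (G : ℂ → ℂ), IsEntireOfFiniteOrder G ∧ ∀ s, s ≠ 1 → (s - 1) ^ m * F s = G s) ∧
    (ContinuousAt F 1 ∨ Tendsto F (𝓝[≠] 1) (Bornology.cobounded ℂ))

/-- Ramanujan hypothesis: `a n ≪ n ^ δ` for every `δ > 0`. -/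
def HasRamanujanBound (a : ℕ → ℂ) : Prop :=
  ∀ δ : ℝ, 0 < δ → a =O[atTop] fun n : ℕ => (n : ℝ) ^ δ

/-- `γ` is an admissible gamma factor for `F`: the function `Φ = γ F` satisfies
`Φ(s) = conj (Φ(1 - conj s))`. This is an identity of meromorphic functions; it is
required at all points at which no factor on either side can have a pole. -/
def GammaFactor.IsAdmissible (γ : GammaFactor) (F : ℂ → ℂ) : Prop :=
  ∀ s : ℂ, s ≠ 0 → s ≠ 1 → ¬ γ.IsPole s → ¬ γ.IsPole (1 - starRingEnd ℂ s) →
    γ.eval s * F s =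
      starRingEnd ℂ (γ.eval (1 - starRingEnd ℂ s) * F (1 - starRingEnd ℂ s))

/-- Euler product: `log F(s) = ∑ b n / n ^ s` for `Re s > 1`, with `b n = 0` unless `n` is a
positive power of a prime, and `b n ≪ n ^ θ` for some `θ < 1 / 2`. -/
def HasEulerProduct (F : ℂ → ℂ) : Prop :=
  ∃ b : ℕ → ℂ,
    (∀ n, ¬ IsPrimePow n → b n = 0) ∧
    (∃ θ : ℝ, θ < 1 / 2 ∧ b =O[atTop] fun n : ℕ => (n : ℝ) ^ θ) ∧
    ∀ s : ℂ, 1 < s.re → ∃ L : ℂ, LSeriesHasSum b s L ∧ Complex.exp L = F s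

/-- The Selberg class. -/
def SelbergClass : Set (ℂ → ℂ) :=
  {F | HasAnalyticity F ∧
    (∃ a : ℕ → ℂ, a 1 = 1 ∧ HasRamanujanBound a ∧
      ∀ s : ℂ, 1 < s.re → LSeriesHasSum a s (F s)) ∧
    (∃ γ : GammaFactor, γ.IsAdmissible F) ∧
    HasEulerProduct F}

/-- The functions in the Selberg class of degree `d`, that is, having an admissible
gamma factor of degree `d`. -/
def SelbergClassOfDegree (d : ℝ) : Set (ℂ → ℂ) :=
  {F | F ∈ SelbergClass ∧ ∃ γ : GammaFactor, γ.IsAdmissible F ∧ γ.degree = d}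

end SelbergDegree

namespace SelbergDegree

/-! Suppose `F` has an admissible gamma factor of degree `d < 1`. Averaging `F(s) N^s` over `Re s =
2` against a Gaussian of width `T` isolates the coefficient `a N`; the other terms are negligible
once `T = N^(1+δ)`, because `log N` is at distance at least `1/(2N)` from every other `log n`. On
`Re s = -A` the functional equation bounds `F` by `|t|^(dA + O(1))`, so shifting the contour there
gives `a N ≪ N^(-A) T^(dA + O(1))` (`norm_coeff_le`). If `(1+δ)d < 1`, letting `A` grow yields decay
faster than every power of `N`. A possible pole at `1` is first cancelled by the factor `(1 -
2^(1-s))^m`, itself a Dirichlet polynomial.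

The resulting series converges absolutely everywhere, so `F` is bounded on each line `Re s = -A`
with `A > 0` (`exists_norm_le_of_degree_lt_one`). But if at least one Gamma function is present, the
Gamma quotient in the functional equation tends to infinity for large `A`, while the Euler product
keeps `F` away from zero on `Re s = 1 + A`. Hence the gamma factor is just `ε Q^s`
(`GammaFactor.IsAdmissible.k_eq_zero`).

In that case the same contour shift gives `a N = 0` for `N > Q^2` (`coeff_eq_zero_of_sq_lt`), so `F`
is a Dirichlet polynomial. Then `b` lives on powers of finitely many primes, and `b n ≪ n^θ` makes
`log F` converge absolutely for `Re s > θ`. Since `θ < 1/2`, the functional equation carries the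
bound on `1/F` to the whole plane, and Liouville's theorem shows that `F` is constant, equal to `a 1
= 1`. -/

/-! ### Quotients of Gamma values along a vertical line -/

/-- The triangle inequality in the Beta integral gives `|B(z, a)| ≤ B(Re z, a)`, and both sides are
Gamma quotients. This takes the place of Stirling's formula. -/
theorem norm_Gamma_mul_Gamma_re_add_le {z : ℂ} (hz : 0 < z.re) {a : ℝ} (ha : 0 ≤ a) :
    ‖Complex.Gamma z‖ * Real.Gamma (z.re + a) ≤ ‖Complex.Gamma (z + a)‖ * Real.Gamma z.re := by
  rcases ha.eq_or_lt with rfl | ha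
  · simp
  have h1 := Complex.Gamma_mul_Gamma_eq_betaIntegral hz (t := (a : ℂ)) (by simpa using ha)
  have h2 := Complex.Gamma_mul_Gamma_eq_betaIntegral (s := (z.re : ℂ)) (by simpa using hz)
    (t := (a : ℂ)) (by simpa using ha)
  have hnorm : ∀ x ∈ Set.Ioo (0 : ℝ) 1,
      ‖(x : ℂ) ^ (z - 1) * (1 - (x : ℂ)) ^ ((a : ℂ) - 1)‖ = x ^ (z.re - 1) * (1 - x) ^ (a - 1) := by
    intro x hx
    have h : (1 - (x : ℂ)) = ((1 - x : ℝ) : ℂ) := by push_cast; ring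
    rw [norm_mul, h, Complex.norm_cpow_eq_rpow_re_of_pos hx.1,
      Complex.norm_cpow_eq_rpow_re_of_pos (sub_pos.2 hx.2)]
    simp
  have hreal : Complex.betaIntegral (z.re : ℂ) a =
      ((∫ x in (0 : ℝ)..1, ‖(x : ℂ) ^ (z - 1) * (1 - (x : ℂ)) ^ ((a : ℂ) - 1)‖ : ℝ) : ℂ) := by
    rw [Complex.betaIntegral, ← intervalIntegral.integral_ofReal]
    apply intervalIntegral.integral_congr_ae
    have h1 : ∀ᵐ x : ℝ, x ≠ 1 := by simp [MeasureTheory.ae_iff]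
    filter_upwards [h1] with x hx1 hx
    rw [Set.uIoc_of_le zero_le_one] at hx
    have hx' : x ∈ Set.Ioo (0 : ℝ) 1 := ⟨hx.1, lt_of_le_of_ne hx.2 hx1⟩
    rw [hnorm x hx', Complex.ofReal_mul, Complex.ofReal_cpow hx'.1.le,
      Complex.ofReal_cpow (sub_pos.2 hx'.2).le]
    push_cast
    rfl
  have hle : ‖Complex.betaIntegral z a‖ ≤
      ∫ x in (0 : ℝ)..1, ‖(x : ℂ) ^ (z - 1) * (1 - (x : ℂ)) ^ ((a : ℂ) - 1)‖ :=
    intervalIntegral.norm_integral_le_integral_norm zero_le_one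
  set J := ∫ x in (0 : ℝ)..1, ‖(x : ℂ) ^ (z - 1) * (1 - (x : ℂ)) ^ ((a : ℂ) - 1)‖ with hJ
  rw [hreal, Complex.Gamma_ofReal, Complex.Gamma_ofReal, ← Complex.ofReal_add,
    Complex.Gamma_ofReal] at h2
  have h2' : Real.Gamma z.re * Real.Gamma a = Real.Gamma (z.re + a) * J := by exact_mod_cast h2
  have h3 := congrArg norm h1
  rw [norm_mul, norm_mul, Complex.Gamma_ofReal, Complex.norm_real,
    Real.norm_of_nonneg (Real.Gamma_pos_of_pos ha).le] at h3
  have ga := Real.Gamma_pos_of_pos ha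
  refine le_of_mul_le_mul_right ?_ ga
  calc ‖Complex.Gamma z‖ * Real.Gamma (z.re + a) * Real.Gamma a
      = (‖Complex.Gamma z‖ * Real.Gamma a) * Real.Gamma (z.re + a) := by ring
    _ = ‖Complex.Gamma (z + a)‖ * ‖Complex.betaIntegral z a‖ * Real.Gamma (z.re + a) := by rw [h3]
    _ ≤ ‖Complex.Gamma (z + a)‖ * J * Real.Gamma (z.re + a) := by
        have := (Real.Gamma_pos_of_pos (add_pos hz ha)).le
        gcongr
    _ = ‖Complex.Gamma (z + a)‖ * Real.Gamma z.re * Real.Gamma a := by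
        rw [mul_assoc, mul_assoc, h2', mul_comm J]

theorem Gamma_add_natCast {z : ℂ} (hz : ∀ n : ℕ, z ≠ -n) (m : ℕ) :
    Complex.Gamma (z + m) = (∏ j ∈ Finset.range m, (z + j)) * Complex.Gamma z := by
  induction m with
  | zero => simp
  | succ m ih =>
    have h : z + m ≠ 0 := fun h => hz m (eq_neg_of_add_eq_zero_left h)
    rw [Finset.prod_range_succ, Nat.cast_succ, ← add_assoc, Complex.Gamma_add_one _ h, ih]
    ring

/-- Round the shift `L` up to an integer by the Beta inequality, then use the recurrence of Gamma.
Rounding costs less than one power of `|t|`, harmless because `A` later tends to infinity. -/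
theorem exists_norm_Gamma_add_le {x L : ℝ} (hx : 0 < x + L) :
    ∃ C : ℝ, 0 < C ∧ ∀ z : ℂ, z.re = x → (∀ n : ℕ, z ≠ -n) →
      ‖Complex.Gamma (z + L)‖ ≤
        C * ((∏ j ∈ Finset.range ⌈L⌉₊, ‖z + j‖) * ‖Complex.Gamma z‖) := by
  have hm : 0 ≤ (⌈L⌉₊ : ℝ) - L := sub_nonneg.2 (Nat.le_ceil L)
  have g1 : 0 < Real.Gamma (x + L) := Real.Gamma_pos_of_pos hx
  have g2 : 0 < Real.Gamma (x + L + (⌈L⌉₊ - L)) := Real.Gamma_pos_of_pos (by linarith)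
  refine ⟨Real.Gamma (x + L) / Real.Gamma (x + L + (⌈L⌉₊ - L)), div_pos g1 g2, ?_⟩
  intro z hz hp
  have hre : (z + L).re = x + L := by simp [hz]
  have h := norm_Gamma_mul_Gamma_re_add_le (z := z + L) (by rw [hre]; exact hx) hm
  have e : z + L + ((⌈L⌉₊ - L : ℝ) : ℂ) = z + (⌈L⌉₊ : ℕ) := by push_cast; ring
  rw [hre, e, Gamma_add_natCast hp, norm_mul, norm_prod] at h
  rw [div_mul_eq_mul_div, le_div_iff₀ g2]
  linarith

/-- The counterpart with `L` rounded down; `1 < x + L` keeps `x + ⌊L⌋₊` positive, as the Beta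
inequality requires. -/
theorem exists_le_norm_Gamma_add {x L : ℝ} (hL : 0 ≤ L) (hx : 1 < x + L) :
    ∃ c : ℝ, 0 < c ∧ ∀ z : ℂ, z.re = x → (∀ n : ℕ, z ≠ -n) →
      c * ((∏ j ∈ Finset.range ⌊L⌋₊, ‖z + j‖) * ‖Complex.Gamma z‖) ≤
        ‖Complex.Gamma (z + L)‖ := by
  have hm : 0 ≤ L - (⌊L⌋₊ : ℝ) := sub_nonneg.2 (Nat.floor_le hL)
  have hlt := Nat.lt_floor_add_one L
  have g1 : 0 < Real.Gamma (x + ⌊L⌋₊ + (L - ⌊L⌋₊)) := Real.Gamma_pos_of_pos (by linarith)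
  have g2 : 0 < Real.Gamma (x + ⌊L⌋₊) := Real.Gamma_pos_of_pos (by linarith)
  refine ⟨Real.Gamma (x + ⌊L⌋₊ + (L - ⌊L⌋₊)) / Real.Gamma (x + ⌊L⌋₊), div_pos g1 g2, ?_⟩
  intro z hz hp
  have hre : (z + (⌊L⌋₊ : ℕ)).re = x + ⌊L⌋₊ := by simp [hz]
  have h := norm_Gamma_mul_Gamma_re_add_le (z := z + (⌊L⌋₊ : ℕ)) (by rw [hre]; linarith) hm
  have e : z + (⌊L⌋₊ : ℕ) + ((L - ⌊L⌋₊ : ℝ) : ℂ) = z + L := by push_cast; ring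
  rw [hre, e, Gamma_add_natCast hp, norm_mul, norm_prod] at h
  rw [div_mul_eq_mul_div, div_le_iff₀ g2]
  linarith

/-! ### Contour shifts and growth in vertical strips -/

open Complex MeasureTheory Set in
theorem integral_vertical_eq_of_norm_le {Φ : ℂ → ℂ} (hΦ : Differentiable ℂ Φ) {a b : ℝ}
    (hab : a ≤ b) {g : ℝ → ℝ} (hg : Integrable g) (hg_top : Tendsto g atTop (𝓝 0))
    (hg_bot : Tendsto g atBot (𝓝 0))
    (hle : ∀ σ t : ℝ, a ≤ σ → σ ≤ b → ‖Φ (σ + t * I)‖ ≤ g t) :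
    ∫ t : ℝ, Φ (a + t * I) = ∫ t : ℝ, Φ (b + t * I) := by
  have hint : ∀ σ : ℝ, a ≤ σ → σ ≤ b → Integrable fun t : ℝ => Φ (σ + t * I) := by
    intro σ h1 h2
    refine hg.mono' ?_ (Eventually.of_forall fun t => hle σ t h1 h2)
    exact (hΦ.continuous.comp (by fun_prop)).aestronglyMeasurable
  have hlim : ∀ σ : ℝ, a ≤ σ → σ ≤ b → Tendsto (fun T : ℝ => ∫ t in (-T)..T, Φ (σ + t * I)) atTop
      (𝓝 (∫ t : ℝ, Φ (σ + t * I))) := fun σ h1 h2 =>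
    intervalIntegral_tendsto_integral (hint σ h1 h2) tendsto_neg_atTop_atBot tendsto_id
  have hor : ∀ u : ℝ → ℝ, Tendsto (fun T => g (u T)) atTop (𝓝 0) →
      Tendsto (fun T : ℝ => ∫ x : ℝ in a..b, Φ (x + (u T : ℝ) * I)) atTop (𝓝 0) := by
    intro u hu
    have hb : ∀ T, ‖∫ x : ℝ in a..b, Φ (x + (u T : ℝ) * I)‖ ≤ g (u T) * |b - a| := by
      intro T
      apply intervalIntegral.norm_integral_le_of_norm_le_const
      intro x hx
      rw [uIoc_of_le hab] at hx
      exact hle x _ hx.1.le hx.2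
    exact squeeze_zero_norm hb (by simpa using hu.mul_const |b - a|)
  have hrect : ∀ T : ℝ, (∫ x : ℝ in a..b, Φ (x + (-T : ℝ) * I)) -
      (∫ x : ℝ in a..b, Φ (x + (T : ℝ) * I)) + I * (∫ t : ℝ in (-T)..T, Φ (b + t * I)) -
      I * (∫ t : ℝ in (-T)..T, Φ (a + t * I)) = 0 := by
    intro T
    have := integral_boundary_rect_eq_zero_of_differentiableOn Φ ⟨a, -T⟩ ⟨b, T⟩
      hΦ.differentiableOn
    simpa [smul_eq_mul] using this
  have hfin := (((hor (fun T => -T) (hg_bot.comp tendsto_neg_atTop_atBot)).sub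
    (hor (fun T => T) hg_top)).add ((hlim b hab le_rfl).const_mul I)).sub
    ((hlim a le_rfl hab).const_mul I)
  have h0 := tendsto_nhds_unique (hfin.congr hrect) tendsto_const_nhds
  have : I * ((∫ t : ℝ, Φ (b + t * I)) - ∫ t : ℝ, Φ (a + t * I)) = 0 := by
    linear_combination h0
  rw [mul_eq_zero, sub_eq_zero] at this
  exact (this.resolve_left I_ne_zero).symm

/-- Growth of finite order in every closed vertical strip. -/
def HasFiniteOrderInStrips (H : ℂ → ℂ) : Prop :=
  ∀ a b : ℝ, ∃ ρ : ℝ, H =O[Bornology.cobounded ℂ ⊓ 𝓟 (Complex.re ⁻¹' Set.Icc a b)]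
    fun s : ℂ => Real.exp (‖s‖ ^ ρ)

theorem half_one_add_abs_im_le_norm {s : ℂ} (h : 1 ≤ s.re) : (1 + |s.im|) / 2 ≤ ‖s‖ := by
  have h1 := Complex.abs_re_le_norm s
  have h2 := Complex.abs_im_le_norm s
  have := le_abs_self s.re
  linarith

open Complex Set in
-- In a strip `|z| ≤ 2|Im z|` far out, and any power of `|Im z|` is eventually below `exp (c|Im
-- z|)`. This is the a priori growth condition of Phragmén–Lindelöf.
theorem HasFiniteOrderInStrips.isBigO_exp_exp {H : ℂ → ℂ} (hH : HasFiniteOrderInStrips H)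
    (a b : ℝ) {c : ℝ} (hc : 0 < c) :
    H =O[comap (_root_.abs ∘ im) atTop ⊓ 𝓟 (re ⁻¹' Ioo a b)]
      fun z => Real.exp (1 * Real.exp (c * |z.im|)) := by
  obtain ⟨ρ, hρ⟩ := hH a b
  have hfil : comap (_root_.abs ∘ im) atTop ⊓ 𝓟 (re ⁻¹' Ioo a b) ≤
      Bornology.cobounded ℂ ⊓ 𝓟 (re ⁻¹' Icc a b) := by
    refine inf_le_inf ?_ (principal_mono.2 (preimage_mono Ioo_subset_Icc_self))
    rw [← comap_norm_atTop]
    refine tendsto_iff_comap.1 ?_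
    exact tendsto_atTop_mono (fun z => abs_im_le_norm z) tendsto_comap
  refine (hρ.mono hfil).trans (IsBigO.of_bound 1 ?_)
  have him : Tendsto (fun z : ℂ => |z.im|) (comap (_root_.abs ∘ im) atTop ⊓ 𝓟 (re ⁻¹' Ioo a b))
      atTop := tendsto_comap.mono_left inf_le_left
  have hlo := (isLittleO_rpow_exp_pos_mul_atTop (max ρ 0) hc).bound
    (show (0 : ℝ) < 1 / 2 ^ (max ρ 0) by positivity)
  filter_upwards [him.eventually hlo, him.eventually_ge_atTop (|a| + |b|), him.eventually_ge_atTop 1,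
    mem_inf_of_right (mem_principal_self _)] with z hz hab h1 hstrip
  rw [one_mul, one_mul, Real.norm_of_nonneg (Real.exp_pos _).le,
    Real.norm_of_nonneg (Real.exp_pos _).le, Real.exp_le_exp]
  rw [Real.norm_of_nonneg (Real.exp_pos _).le, Real.norm_of_nonneg (by positivity)] at hz
  have hre : |z.re| ≤ |a| + |b| := by
    rw [abs_le]
    have := hstrip.1; have := hstrip.2
    constructor <;>
    · have := neg_abs_le a; have := le_abs_self b; have := abs_nonneg a; have := abs_nonneg b
      linarith
  have hn : ‖z‖ ≤ 2 * |z.im| := (norm_le_abs_re_add_abs_im z).trans (by linarith)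
  have hn1 : 1 ≤ ‖z‖ := h1.trans (abs_im_le_norm z)
  calc ‖z‖ ^ ρ ≤ ‖z‖ ^ (max ρ 0) := Real.rpow_le_rpow_of_exponent_le hn1 (le_max_left _ _)
    _ ≤ (2 * |z.im|) ^ (max ρ 0) := Real.rpow_le_rpow (norm_nonneg _) hn (le_max_right _ _)
    _ = 2 ^ (max ρ 0) * |z.im| ^ (max ρ 0) := Real.mul_rpow (by norm_num) (abs_nonneg _)
    _ ≤ 2 ^ (max ρ 0) * (1 / 2 ^ (max ρ 0) * Real.exp (c * |z.im|)) := by gcongr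
    _ = Real.exp (c * |z.im|) := by field_simp

open Complex Set in
theorem HasFiniteOrderInStrips.exists_norm_le {H : ℂ → ℂ} (hH : HasFiniteOrderInStrips H)
    (hd : Differentiable ℂ H) {A c C M : ℝ} (hAc : -A < c) {κ : ℕ}
    (hA : ∀ t : ℝ, ‖H (-A + t * I)‖ ≤ C * (1 + |t|) ^ κ) (hc : ∀ t : ℝ, ‖H (c + t * I)‖ ≤ M) :
    ∃ K : ℝ, ∀ σ t : ℝ, -A ≤ σ → σ ≤ c → ‖H (σ + t * I)‖ ≤ K * (1 + |t|) ^ κ := by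
  have hM : 0 ≤ M := (norm_nonneg _).trans (hc 0)
  have hC : 0 ≤ C := by simpa using (norm_nonneg _).trans (hA 0)
  -- The divisor has real part at least `1` before taking powers, so it has no zeros in the strip;
  -- it absorbs the growth on the left edge and leaves `f` bounded on both edges.
  set f : ℂ → ℂ := fun s => H s / (s + A + 1) ^ κ with hf
  have hre : ∀ s : ℂ, -A ≤ s.re → 1 ≤ (s + A + 1).re := by intro s hs; simp; linarith
  have hne : ∀ s : ℂ, -A ≤ s.re → s + A + 1 ≠ 0 := by
    intro s hs h
    have := hre s hs
    rw [h] at this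
    simp at this
    linarith
  have hone : ∀ s : ℂ, -A ≤ s.re → 1 ≤ ‖s + A + 1‖ := fun s hs =>
    (hre s hs).trans ((le_abs_self _).trans (abs_re_le_norm _))
  have hdf : ∀ s : ℂ, -A ≤ s.re → DifferentiableAt ℂ f s := by
    intro s hs
    exact (hd s).div (by fun_prop) (pow_ne_zero _ (hne s hs))
  have hPL : ∀ s : ℂ, -A ≤ s.re → s.re ≤ c → ‖f s‖ ≤ max (C * 2 ^ κ) M := by
    intro s h1 h2
    refine PhragmenLindelof.vertical_strip (a := -A) (b := c) ?_ ?_ ?_ ?_ h1 h2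
    · apply DifferentiableOn.diffContOnCl
      intro z hz
      have hz' : z ∈ re ⁻¹' closure (Ioo (-A) c) :=
        closure_minimal (preimage_mono subset_closure)
          (isClosed_closure.preimage continuous_re) hz
      rw [closure_Ioo hAc.ne] at hz'
      exact (hdf z hz'.1).differentiableWithinAt
    · have hpos : 0 < Real.pi / (c - -A) := div_pos Real.pi_pos (by linarith)
      refine ⟨Real.pi / (c - -A) / 2, half_lt_self hpos, 1, ?_⟩
      refine IsBigO.trans (IsBigO.of_bound 1 ?_) (hH.isBigO_exp_exp (-A) c (half_pos hpos))
      filter_upwards [mem_inf_of_right (mem_principal_self _)] with z hz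
      have h : 1 ≤ ‖z + A + 1‖ ^ κ := one_le_pow₀ (hone z hz.1.le)
      rw [one_mul, hf, norm_div, norm_pow]
      exact div_le_self (norm_nonneg _) h
    · intro z hz
      have hz0 := half_one_add_abs_im_le_norm (hre z hz.ge)
      have him : (z + A + 1).im = z.im := by simp
      have e : z = -A + z.im * I := by
        apply Complex.ext <;> simp [hz]
      rw [him] at hz0
      refine le_max_of_le_left ?_
      have hp : 0 < ‖z + A + 1‖ := one_pos.trans_le (hone z hz.ge)
      rw [hf, norm_div, norm_pow, div_le_iff₀ (pow_pos hp κ)]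
      have h3 := hA z.im
      rw [← e] at h3
      refine h3.trans ?_
      rw [mul_assoc, ← mul_pow]
      gcongr
      linarith
    · intro z hz
      have e : z = c + z.im * I := by
        apply Complex.ext <;> simp [hz]
      refine le_max_of_le_right ?_
      have h3 := hc z.im
      rw [← e] at h3
      have h : 1 ≤ ‖z + A + 1‖ ^ κ := one_le_pow₀ (hone z (by linarith))
      rw [hf, norm_div, norm_pow]
      exact (div_le_self (norm_nonneg _) h).trans h3
  refine ⟨max (C * 2 ^ κ) M * (c + A + 1) ^ κ, fun σ t h1 h2 => ?_⟩
  have hs := hPL (σ + t * I) (by simpa) (by simpa)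
  have hp : 0 < ‖(σ + t * I : ℂ) + A + 1‖ := one_pos.trans_le (hone _ (by simpa))
  rw [hf, norm_div, norm_pow, div_le_iff₀ (pow_pos hp κ)] at hs
  refine hs.trans ?_
  rw [mul_assoc, ← mul_pow]
  have hn : ‖(σ + t * I : ℂ) + A + 1‖ ≤ (c + A + 1) * (1 + |t|) := by
    refine (norm_le_abs_re_add_abs_im _).trans ?_
    have e1 : ((σ + t * I : ℂ) + A + 1).re = σ + A + 1 := by simp
    have e2 : ((σ + t * I : ℂ) + A + 1).im = t := by simp
    rw [e1, e2, abs_of_nonneg (by linarith)]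
    nlinarith [abs_nonneg t]
  gcongr

/-! ### Gaussian averages and the extraction of a single coefficient -/

theorem integrable_one_add_abs_pow_mul_exp (κ : ℕ) {b : ℝ} (hb : 0 < b) :
    MeasureTheory.Integrable fun t : ℝ => (1 + |t|) ^ κ * Real.exp (-b * t ^ 2) := by
  have h : ∀ j : ℕ, MeasureTheory.Integrable fun t : ℝ => |t| ^ j * Real.exp (-b * t ^ 2) := by
    intro j
    have := (integrable_rpow_mul_exp_neg_mul_sq hb (s := j)
      (by have : (0 : ℝ) ≤ j := j.cast_nonneg
          linarith)).norm
    refine this.congr (Eventually.of_forall fun t => ?_)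
    simp
  have e : (fun t : ℝ => (1 + |t|) ^ κ * Real.exp (-b * t ^ 2)) = fun t : ℝ =>
      ∑ j ∈ Finset.range (κ + 1), (κ.choose j : ℝ) * (|t| ^ j * Real.exp (-b * t ^ 2)) := by
    funext t
    rw [add_comm 1, add_pow, Finset.sum_mul]
    refine Finset.sum_congr rfl fun j _ => ?_
    ring
  rw [e]
  exact MeasureTheory.integrable_finsetSum _ fun j _ => (h j).const_mul _

theorem tendsto_one_add_abs_pow_mul_exp (κ : ℕ) {b : ℝ} (hb : 0 < b) :
    Tendsto (fun t : ℝ => (1 + |t|) ^ κ * Real.exp (-b * t ^ 2)) atTop (𝓝 0) ∧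
    Tendsto (fun t : ℝ => (1 + |t|) ^ κ * Real.exp (-b * t ^ 2)) atBot (𝓝 0) := by
  have h1 : Tendsto (fun t : ℝ => (1 + |t|) ^ κ * Real.exp (-b * t ^ 2)) atTop (𝓝 0) := by
    have h2 : Tendsto (fun t : ℝ => (1 + t) ^ κ * Real.exp (-b * (1 + t))) atTop (𝓝 0) := by
      have h3 := (isLittleO_pow_exp_pos_mul_atTop κ hb).tendsto_div_nhds_zero
      have h4 := h3.comp (tendsto_atTop_add_const_left atTop (1 : ℝ) tendsto_id)
      refine h4.congr fun t => ?_
      simp only [Function.comp, id, div_eq_mul_inv, ← Real.exp_neg, neg_mul]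
    refine squeeze_zero' (Eventually.of_forall fun t => by positivity) ?_ h2
    filter_upwards [eventually_ge_atTop 2] with t ht
    rw [abs_of_nonneg (by linarith)]
    gcongr ?_ * Real.exp ?_
    nlinarith [mul_nonneg hb.le (show 0 ≤ t ^ 2 - (1 + t) by nlinarith)]
  refine ⟨h1, ?_⟩
  refine (h1.comp tendsto_neg_atBot_atTop).congr fun t => ?_
  simp

/-- The Gaussian moment `E (1 + |X|) ^ κ` of a standard normal variable `X`. -/
noncomputable def gaussianMoment (κ : ℕ) : ℝ :=
  (∫ u : ℝ, (1 + |u|) ^ κ * Real.exp (-(1 / 2) * u ^ 2)) / √(2 * Real.pi)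

theorem gaussianMoment_zero : gaussianMoment 0 = 1 := by
  have h : (∫ u : ℝ, Real.exp (-(1 / 2) * u ^ 2)) = √(2 * Real.pi) := by
    rw [integral_gaussian]; congr 1; ring
  have : √(2 * Real.pi) ≠ 0 := by positivity
  simp only [gaussianMoment, pow_zero, one_mul]
  rw [h, div_self this]

theorem gaussianMoment_nonneg (κ : ℕ) : 0 ≤ gaussianMoment κ :=
  div_nonneg (MeasureTheory.integral_nonneg fun u => by positivity) (Real.sqrt_nonneg _)

theorem integral_one_add_abs_pow_mul_exp_le (κ : ℕ) {T : ℝ} (hT : 1 ≤ T) :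
    ∫ t : ℝ, (1 + |t|) ^ κ * Real.exp (-(1 / (2 * T ^ 2)) * t ^ 2) ≤
      √(2 * Real.pi) * T * (T ^ κ * gaussianMoment κ) := by
  have hT0 : 0 < T := by linarith
  have h := MeasureTheory.Measure.integral_comp_mul_left
    (fun t : ℝ => (1 + |t|) ^ κ * Real.exp (-(1 / (2 * T ^ 2)) * t ^ 2)) T
  rw [abs_of_pos (inv_pos.2 hT0), smul_eq_mul] at h
  have h' : ∫ t : ℝ, (1 + |t|) ^ κ * Real.exp (-(1 / (2 * T ^ 2)) * t ^ 2) =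
      T * ∫ u : ℝ, (1 + |T * u|) ^ κ * Real.exp (-(1 / (2 * T ^ 2)) * (T * u) ^ 2) := by
    rw [h]; field_simp
  have hle : ∫ u : ℝ, (1 + |T * u|) ^ κ * Real.exp (-(1 / (2 * T ^ 2)) * (T * u) ^ 2) ≤
      ∫ u : ℝ, T ^ κ * ((1 + |u|) ^ κ * Real.exp (-(1 / 2) * u ^ 2)) := by
    refine MeasureTheory.integral_mono_of_nonneg (Eventually.of_forall fun u => ?_)
      ((integrable_one_add_abs_pow_mul_exp κ (by norm_num)).const_mul _)
      (Eventually.of_forall fun u => ?_)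
    · change 0 ≤ (1 + |T * u|) ^ κ * Real.exp (-(1 / (2 * T ^ 2)) * (T * u) ^ 2)
      positivity
    · have e : -(1 / (2 * T ^ 2)) * (T * u) ^ 2 = -(1 / 2) * u ^ 2 := by field_simp
      simp only
      rw [e, ← mul_assoc, ← mul_pow, abs_mul, abs_of_pos hT0]
      gcongr
      nlinarith [abs_nonneg u]
  have hs : √(2 * Real.pi) ≠ 0 := by positivity
  rw [MeasureTheory.integral_const_mul] at hle
  rw [h', gaussianMoment]
  calc _ ≤ T * (T ^ κ * ∫ u : ℝ, (1 + |u|) ^ κ * Real.exp (-(1 / 2) * u ^ 2)) := by gcongr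
    _ = _ := by field_simp

/-- From `log x ≥ 1 - 1/x`, the gap between the logarithms is at least `1/(2N)`. This spacing
decides how large `T` must be. -/
theorem one_div_le_log_sub_log_sq {n N : ℕ} (hn : n ≠ 0) (hN : N ≠ 0) (h : n ≠ N) :
    1 / (4 * (N : ℝ) ^ 2) ≤ (Real.log N - Real.log n) ^ 2 := by
  have hn0 : (0 : ℝ) < n := by positivity
  have hN0 : (0 : ℝ) < N := by positivity
  have hN1 : (1 : ℝ) ≤ N := by exact_mod_cast Nat.one_le_iff_ne_zero.2 hN
  have key : 1 / (2 * (N : ℝ)) ≤ |Real.log N - Real.log n| := by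
    rcases lt_or_gt_of_ne h with h | h
    · have h' : (n : ℝ) + 1 ≤ N := by exact_mod_cast h
      refine le_trans ?_ (le_abs_self _)
      rw [← Real.log_div hN0.ne' hn0.ne']
      refine le_trans ?_ (Real.one_sub_inv_le_log_of_pos (div_pos hN0 hn0))
      rw [inv_div, div_le_iff₀ (by positivity)]
      field_simp
      linarith
    · have h' : (N : ℝ) + 1 ≤ n := by exact_mod_cast h
      rw [abs_sub_comm]
      refine le_trans ?_ (le_abs_self _)
      rw [← Real.log_div hn0.ne' hN0.ne']
      refine le_trans ?_ (Real.one_sub_inv_le_log_of_pos (div_pos hn0 hN0))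
      rw [inv_div, div_le_iff₀ (by positivity)]
      have : (N : ℝ) / n ≤ N / (N + 1) := by gcongr
      have h2 : (1 - (N : ℝ) / (N + 1)) * (2 * N) ≤ (1 - N / n) * (2 * N) := by gcongr
      refine le_trans ?_ h2
      have e : (1 - (N : ℝ) / (N + 1)) * (2 * N) = 2 * N / (N + 1) := by field_simp; ring
      rw [e, le_div_iff₀ (by positivity)]
      linarith
  calc 1 / (4 * (N : ℝ) ^ 2) = (1 / (2 * (N : ℝ))) ^ 2 := by field_simp; norm_num
    _ ≤ |Real.log N - Real.log n| ^ 2 := by gcongr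
    _ = _ := sq_abs _

open Complex MeasureTheory in
theorem integral_cexp_mul_gaussian {T : ℝ} (hT : 0 < T) (x : ℝ) :
    ∫ t : ℝ, cexp (I * x * t) * cexp (-((1 / (2 * T ^ 2) : ℝ) : ℂ) * (t : ℂ) ^ 2) =
      ((√(2 * Real.pi) * T * Real.exp (-(T ^ 2 * x ^ 2 / 2)) : ℝ) : ℂ) := by
  have hb : 0 < ((1 / (2 * T ^ 2) : ℝ) : ℂ).re := by rw [ofReal_re]; positivity
  rw [fourierIntegral_gaussian hb]
  have e1 : ((Real.pi : ℂ) / ((1 / (2 * T ^ 2) : ℝ) : ℂ)) = ((2 * Real.pi * T ^ 2 : ℝ) : ℂ) := by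
    push_cast
    have : (T : ℂ) ≠ 0 := by exact_mod_cast hT.ne'
    field_simp
  have e2 : -(x : ℂ) ^ 2 / (4 * ((1 / (2 * T ^ 2) : ℝ) : ℂ)) = ((-(T ^ 2 * x ^ 2 / 2) : ℝ) : ℂ) := by
    push_cast
    have : (T : ℂ) ≠ 0 := by exact_mod_cast hT.ne'
    field_simp
    norm_num
  have e3 : ((1 / 2 : ℂ)) = ((1 / 2 : ℝ) : ℂ) := by push_cast; rfl
  rw [e1, e2, e3, ← ofReal_cpow (by positivity), ← Real.sqrt_eq_rpow,
    Real.sqrt_mul (by positivity), Real.sqrt_sq hT.le, ← ofReal_exp, ← ofReal_mul]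

open Complex MeasureTheory in
-- Termwise integration, justified by absolute convergence at `2`: the `n`-th term picks up the
-- Fourier transform of the Gaussian at `log N - log n`.
theorem hasSum_integral_LSeries_mul_gaussian {a : ℕ → ℂ} (ha : LSeriesSummable a 2) {N : ℕ}
    (hN : N ≠ 0) {T : ℝ} (hT : 0 < T) :
    HasSum (fun n => LSeries.term a 2 n * N ^ 2 *
        ((√(2 * Real.pi) * T * Real.exp (-(T ^ 2 * (Real.log N - Real.log n) ^ 2 / 2)) : ℝ) : ℂ))
      (∫ t : ℝ, LSeries a (2 + t * I) * (N : ℂ) ^ (2 + t * I) *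
        cexp (-((1 / (2 * T ^ 2) : ℝ) : ℂ) * (t : ℂ) ^ 2)) := by
  set b : ℝ := 1 / (2 * T ^ 2) with hb
  have hb0 : 0 < b := by positivity
  have hN0 : (N : ℂ) ≠ 0 := by exact_mod_cast hN
  set F : ℕ → ℝ → ℂ := fun n t => LSeries.term a (2 + t * I) n * (N : ℂ) ^ (2 + t * I) *
    cexp (-(b : ℂ) * (t : ℂ) ^ 2) with hF
  have hform : ∀ n t, F n t = LSeries.term a 2 n * N ^ 2 *
      (cexp (I * ((Real.log N - Real.log n : ℝ) : ℂ) * t) * cexp (-(b : ℂ) * (t : ℂ) ^ 2)) := by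
    intro n t
    rcases eq_or_ne n 0 with rfl | hn
    · simp [hF]
    have hn0 : (n : ℂ) ≠ 0 := by exact_mod_cast hn
    simp only [hF]
    rw [LSeries.term_of_ne_zero hn, LSeries.term_of_ne_zero hn, cpow_add _ _ hn0,
      cpow_add _ _ hN0, cpow_def_of_ne_zero hn0 (t * I), cpow_def_of_ne_zero hN0 (t * I),
      ← natCast_log, ← natCast_log]
    have e : I * ((Real.log N - Real.log n : ℝ) : ℂ) * t =
        Real.log N * (t * I) - Real.log n * (t * I) := by push_cast; ring
    rw [e, exp_sub]
    have h2 : (n : ℂ) ^ (2 : ℂ) ≠ 0 := by simp [hn]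
    have h2' : (N : ℂ) ^ (2 : ℂ) = (N : ℂ) ^ 2 := by norm_cast
    rw [h2']
    have := exp_ne_zero (Real.log n * (t * I))
    field_simp
  have hgauss : ∀ t : ℝ, ‖cexp (-(b : ℂ) * (t : ℂ) ^ 2)‖ = Real.exp (-b * t ^ 2) := by
    intro t
    rw [← ofReal_neg, ← ofReal_pow, ← ofReal_mul, ← ofReal_exp, norm_real,
      Real.norm_of_nonneg (Real.exp_pos _).le]
  have hnorm : ∀ n t, ‖F n t‖ = ‖LSeries.term a 2 n * N ^ 2‖ * Real.exp (-b * t ^ 2) := by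
    intro n t
    have e : I * ((Real.log N - Real.log n : ℝ) : ℂ) * t =
        (((Real.log N - Real.log n) * t : ℝ) : ℂ) * I := by push_cast; ring
    rw [hform, norm_mul, norm_mul _ (cexp _), hgauss, e, norm_exp_ofReal_mul_I, one_mul]
  have hint : ∀ n, Integrable (F n) := by
    intro n
    refine ((integrable_exp_neg_mul_sq hb0).const_mul ‖LSeries.term a 2 n * N ^ 2‖).mono' ?_
      (Eventually.of_forall fun t => (hnorm n t).le)
    rw [show F n = _ from funext (hform n)]
    exact Continuous.aestronglyMeasurable (by fun_prop)
  have hsum : Summable fun n => ∫ t, ‖F n t‖ := by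
    simp_rw [hnorm, integral_const_mul, norm_mul]
    exact (ha.norm.mul_right _).mul_right _
  have h := hasSum_integral_of_summable_integral_norm hint hsum
  have e1 : (fun n => ∫ t, F n t) = fun n => LSeries.term a 2 n * N ^ 2 *
      ((√(2 * Real.pi) * T * Real.exp (-(T ^ 2 * (Real.log N - Real.log n) ^ 2 / 2)) : ℝ) : ℂ) := by
    funext n
    simp_rw [hform, integral_const_mul, hb, integral_cexp_mul_gaussian hT]
  have e2 : (fun t => ∑' n, F n t) = fun t : ℝ => LSeries a (2 + t * I) * (N : ℂ) ^ (2 + t * I) *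
      cexp (-(b : ℂ) * (t : ℂ) ^ 2) := by
    funext t
    simp only [hF, tsum_mul_right, LSeries]
  rwa [e1, e2] at h

open Complex MeasureTheory in
-- The first summand is the off-diagonal error on `Re s = 2`, the second the integral moved to `Re s
-- = -A`. Both are divided by the Gaussian mass `√(2π) T`.
theorem norm_coeff_le {H : ℂ → ℂ} (hH : HasFiniteOrderInStrips H) (hd : Differentiable ℂ H)
    {a : ℕ → ℂ} (ha : ∀ s : ℂ, 1 < s.re → LSeriesHasSum a s (H s)) {A C : ℝ} (hA : 0 ≤ A) {κ : ℕ}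
    (hle : ∀ t : ℝ, ‖H (-A + t * I)‖ ≤ C * (1 + |t|) ^ κ) {N : ℕ} (hN : N ≠ 0) {T : ℝ}
    (hT : 1 ≤ T) :
    ‖a N‖ ≤ N ^ 2 * Real.exp (-(T ^ 2 / (8 * N ^ 2))) * (∑' n, ‖LSeries.term a 2 n‖) +
      C * (N : ℝ) ^ (-A) * Real.exp ((A + 2) ^ 2 / (2 * T ^ 2)) * (T ^ κ * gaussianMoment κ) := by
  have hT0 : 0 < T := by linarith
  have hN0 : (N : ℂ) ≠ 0 := by exact_mod_cast hN
  have hNpos : 0 < N := Nat.pos_of_ne_zero hN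
  have hNr : (1 : ℝ) ≤ N := by exact_mod_cast hNpos
  set b : ℝ := 1 / (2 * T ^ 2) with hb
  have hb0 : 0 < b := by positivity
  have hsum2 : LSeriesSummable a 2 := (ha 2 (by simp)).LSeriesSummable
  set S : ℝ := ∑' n, ‖LSeries.term a 2 n‖ with hS
  set G : ℝ := √(2 * Real.pi) * T with hG
  have hG0 : 0 < G := by positivity
  set Φ : ℂ → ℂ := fun s => H s * (N : ℂ) ^ s * cexp (b * (s - 2) ^ 2) with hΦ
  have hΦd : Differentiable ℂ Φ := by
    refine (hd.mul ?_).mul ?_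
    · exact Differentiable.const_cpow differentiable_id (Or.inl hN0)
    · fun_prop
  have hline : ∀ t : ℝ, ‖H ((2 : ℝ) + t * I)‖ ≤ S := by
    intro t
    have h := (ha ((2 : ℝ) + t * I) (by simp)).LSeries_eq
    rw [← h]
    have hn : ∀ n, ‖LSeries.term a ((2 : ℝ) + t * I) n‖ = ‖LSeries.term a 2 n‖ := by
      intro n; simp [LSeries.norm_term_eq]
    refine (norm_tsum_le_tsum_norm ?_).trans (le_of_eq (tsum_congr hn))
    exact hsum2.norm.congr fun n => (hn n).symm
  -- `K` only justifies the contour shift; it does not enter the final bound.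
  obtain ⟨K, hK⟩ := hH.exists_norm_le hd (c := 2) (by linarith) hle hline
  have hK0 : 0 ≤ K := by simpa using (norm_nonneg _).trans (hK 0 0 (by linarith) (by norm_num))
  have hNs : ∀ σ t : ℝ, ‖(N : ℂ) ^ (σ + t * I)‖ = (N : ℝ) ^ σ := by
    intro σ t
    rw [norm_natCast_cpow_of_pos hNpos]; simp
  have hexp : ∀ σ t : ℝ, ‖cexp (b * ((σ + t * I : ℂ) - 2) ^ 2)‖ =
      Real.exp (b * (σ - 2) ^ 2) * Real.exp (-b * t ^ 2) := by
    intro σ t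
    rw [norm_exp, ← Real.exp_add]
    congr 1
    have : (b : ℂ) * ((σ + t * I : ℂ) - 2) ^ 2 =
        ((b * ((σ - 2) ^ 2 - t ^ 2) : ℝ) : ℂ) + ((b * (2 * (σ - 2) * t) : ℝ) : ℂ) * I := by
      push_cast
      linear_combination (b : ℂ) * t ^ 2 * I_sq
    rw [this, add_re, ofReal_re, re_ofReal_mul, I_re]
    ring
  have hΦn : ∀ σ t : ℝ, ‖Φ (σ + t * I)‖ = ‖H (σ + t * I)‖ * (N : ℝ) ^ σ *
      (Real.exp (b * (σ - 2) ^ 2) * Real.exp (-b * t ^ 2)) := by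
    intro σ t
    simp only [hΦ]
    rw [norm_mul, norm_mul, hNs, hexp]
  have hexpA : ∀ σ : ℝ, -A ≤ σ → σ ≤ 2 → Real.exp (b * (σ - 2) ^ 2) ≤ Real.exp (b * (A + 2) ^ 2) := by
    intro σ h1 h2
    have : (σ - 2) ^ 2 ≤ (A + 2) ^ 2 := by nlinarith
    gcongr
  have hlim := (tendsto_one_add_abs_pow_mul_exp κ hb0).imp
    (fun h => h.const_mul (K * (N : ℝ) ^ (2 : ℝ) * Real.exp (b * (A + 2) ^ 2)))
    (fun h => h.const_mul (K * (N : ℝ) ^ (2 : ℝ) * Real.exp (b * (A + 2) ^ 2)))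
  have hshift := integral_vertical_eq_of_norm_le hΦd (a := -A) (b := 2) (by linarith)
    ((integrable_one_add_abs_pow_mul_exp κ hb0).const_mul
      (K * (N : ℝ) ^ (2 : ℝ) * Real.exp (b * (A + 2) ^ 2)))
    (by simpa only [mul_zero] using hlim.1)
    (by simpa only [mul_zero] using hlim.2)
    (by
      intro σ t h1 h2
      rw [hΦn]
      have hp : (N : ℝ) ^ σ ≤ (N : ℝ) ^ (2 : ℝ) := Real.rpow_le_rpow_of_exponent_le hNr h2
      calc _ ≤ (K * (1 + |t|) ^ κ) * (N : ℝ) ^ (2 : ℝ) *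
            (Real.exp (b * (A + 2) ^ 2) * Real.exp (-b * t ^ 2)) := by
            gcongr ?_ * ?_ * (?_ * _)
            · exact hK σ t h1 h2
            · exact hexpA σ h1 h2
        _ = _ := by ring)
  have hleft : ‖∫ t : ℝ, Φ ((-A : ℝ) + t * I)‖ ≤
      C * (N : ℝ) ^ (-A) * Real.exp ((A + 2) ^ 2 / (2 * T ^ 2)) *
        (G * (T ^ κ * gaussianMoment κ)) := by
    have hC : 0 ≤ C := by simpa using (norm_nonneg _).trans (hle 0)
    have hp : ∀ t : ℝ, ‖Φ ((-A : ℝ) + t * I)‖ ≤ C * (N : ℝ) ^ (-A) * Real.exp (b * (A + 2) ^ 2) *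
        ((1 + |t|) ^ κ * Real.exp (-b * t ^ 2)) := by
      intro t
      rw [hΦn]
      have h1 := hle t
      rw [← ofReal_neg] at h1
      calc _ ≤ (C * (1 + |t|) ^ κ) * (N : ℝ) ^ (-A) *
            (Real.exp (b * (A + 2) ^ 2) * Real.exp (-b * t ^ 2)) := by
            gcongr ?_ * _ * (?_ * _)
            exact hexpA (-A) le_rfl (by linarith)
        _ = _ := by ring
    refine (norm_integral_le_of_norm_le
      ((integrable_one_add_abs_pow_mul_exp κ hb0).const_mul _) (Eventually.of_forall hp)).trans ?_
    rw [integral_const_mul]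
    have e : b * (A + 2) ^ 2 = (A + 2) ^ 2 / (2 * T ^ 2) := by rw [hb]; ring
    rw [e]
    gcongr
    exact integral_one_add_abs_pow_mul_exp_le κ hT
  have hright := hasSum_integral_LSeries_mul_gaussian hsum2 hN hT0
  have hRint : (∫ t : ℝ, LSeries a (2 + t * I) * (N : ℂ) ^ (2 + t * I) *
      cexp (-(b : ℂ) * (t : ℂ) ^ 2)) = ∫ t : ℝ, Φ ((2 : ℝ) + t * I) := by
    refine integral_congr_ae (Eventually.of_forall fun t => ?_)
    simp only [hΦ]
    rw [(ha (2 + t * I) (by simp)).LSeries_eq]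
    congr 2
    push_cast
    linear_combination (-(b : ℂ) * t ^ 2) * I_sq
  rw [← hb, hRint, ← hshift] at hright
  set J := ∫ t : ℝ, Φ ((-A : ℝ) + t * I) with hJ
  -- Subtracting the diagonal term leaves a series whose `N`-th term is zero and whose other terms
  -- carry the small Gaussian weight.
  have hterm := hright.sub (hasSum_ite_eq N (a N * (G : ℂ)))
  have hbound : ‖J - a N * (G : ℂ)‖ ≤ ∑' n, ‖LSeries.term a 2 n‖ *
      (N ^ 2 * (G * Real.exp (-(T ^ 2 / (8 * N ^ 2))))) := by
    rw [← hterm.tsum_eq]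
    refine tsum_of_norm_bounded (hsum2.norm.mul_right _).hasSum fun n => ?_
    by_cases hnN : n = N
    · have h2' : (N : ℂ) ^ (2 : ℂ) = (N : ℂ) ^ 2 := by norm_cast
      have hz : LSeries.term a 2 n * (N : ℂ) ^ 2 * ((G * Real.exp (-(T ^ 2 *
          (Real.log N - Real.log n) ^ 2 / 2)) : ℝ) : ℂ) - (if n = N then a N * (G : ℂ) else 0) = 0 := by
        rw [hnN, LSeries.term_of_ne_zero hN, h2', div_mul_cancel₀ _ (pow_ne_zero 2 hN0)]
        simp
      rw [hz, norm_zero]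
      positivity
    · rw [if_neg hnN, sub_zero]
      rcases eq_or_ne n 0 with rfl | hn
      · simp
      rw [norm_mul, norm_mul, mul_assoc, norm_pow, Complex.norm_natCast, norm_real,
        Real.norm_of_nonneg (by positivity)]
      have hl := one_div_le_log_sub_log_sq hn hN hnN
      have hx : T ^ 2 / (8 * N ^ 2) ≤ T ^ 2 * (Real.log N - Real.log n) ^ 2 / 2 := by
        calc T ^ 2 / (8 * (N : ℝ) ^ 2) = T ^ 2 * (1 / (4 * (N : ℝ) ^ 2)) / 2 := by
              field_simp; norm_num
          _ ≤ _ := by gcongr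
      gcongr
  rw [tsum_mul_right, ← hS] at hbound
  have hfin : ‖a N * (G : ℂ)‖ ≤ S * (N ^ 2 * (G * Real.exp (-(T ^ 2 / (8 * N ^ 2))))) +
      C * (N : ℝ) ^ (-A) * Real.exp ((A + 2) ^ 2 / (2 * T ^ 2)) *
        (G * (T ^ κ * gaussianMoment κ)) := by
    have : a N * (G : ℂ) = J - (J - a N * (G : ℂ)) := by ring
    rw [this]
    refine (norm_sub_le _ _).trans ?_
    linarith
  rw [norm_mul, norm_real, Real.norm_of_nonneg hG0.le] at hfin
  refine le_of_mul_le_mul_right (hfin.trans (le_of_eq ?_)) hG0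
  ring

/-! ### The gamma factor on the lines `Re s = -A` and `Re s = 1 + A` -/

open Complex

namespace GammaFactor

variable (γ : GammaFactor)

/-- The line `Re s = -A` contains no pole of `γ`. -/
def IsPoleFreeLine (A : ℝ) : Prop :=
  ∀ (i : Fin γ.k) (n : ℕ), γ.w i * -A + (γ.μ i).re ≠ -n

/-- Each pair `(i, n)` excludes a single `A`, so only countably many values are lost. -/
theorem exists_isPoleFreeLine_gt (B : ℝ) : ∃ A, B < A ∧ γ.IsPoleFreeLine A := by
  have hc : (⋃ (i : Fin γ.k) (n : ℕ), {A : ℝ | γ.w i * -A + (γ.μ i).re = -n}).Countable := by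
    refine Set.countable_iUnion fun i => Set.countable_iUnion fun n => ?_
    refine Set.Subsingleton.countable fun A hA A' hA' => ?_
    have h : γ.w i * (A - A') = 0 := by
      simp only [Set.mem_ofPred_eq] at hA hA'
      linarith
    rw [mul_eq_zero, sub_eq_zero] at h
    exact h.resolve_left (γ.w_pos i).ne'
  obtain ⟨A, hA, hB⟩ := (hc.dense_compl ℝ).exists_gt B
  refine ⟨A, hB, fun i n h => hA ?_⟩
  simp only [Set.mem_iUnion, Set.mem_ofPred_eq]
  exact ⟨i, n, h⟩

variable {γ}

theorem norm_eval (s : ℂ) :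
    ‖γ.eval s‖ = γ.Q ^ s.re * ∏ i, ‖Gamma ((γ.w i : ℂ) * s + γ.μ i)‖ := by
  rw [eval, norm_mul, norm_mul, γ.norm_ε, one_mul, norm_prod,
    norm_cpow_eq_rpow_re_of_pos γ.Q_pos]

theorem arg_re (i : Fin γ.k) (A t : ℝ) :
    ((γ.w i : ℂ) * (-A + t * I) + γ.μ i).re = γ.w i * -A + (γ.μ i).re := by
  simp

theorem arg_im (i : Fin γ.k) (A t : ℝ) :
    ((γ.w i : ℂ) * (-A + t * I) + γ.μ i).im = γ.w i * t + (γ.μ i).im := by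
  simp

theorem arg_reflect (i : Fin γ.k) (A t : ℝ) :
    (γ.w i : ℂ) * (1 + A + t * I) + γ.μ i =
      ((γ.w i : ℂ) * (-A + t * I) + γ.μ i) + (γ.w i * (1 + 2 * A) : ℝ) := by
  push_cast; ring

theorem IsPoleFreeLine.arg_ne {A : ℝ} (hA : γ.IsPoleFreeLine A) (i : Fin γ.k) (t : ℝ) (n : ℕ) :
    (γ.w i : ℂ) * (-A + t * I) + γ.μ i ≠ -n := by
  intro h
  have := congrArg re h
  rw [arg_re] at this
  exact hA i n (by simpa using this)

theorem not_isPole_of_re_pos {s : ℂ} (hs : 0 < s.re) : ¬ γ.IsPole s := by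
  rintro ⟨i, n, h⟩
  have h1 := congrArg re h
  have h2 : 0 < γ.w i * s.re := mul_pos (γ.w_pos i) hs
  have h3 := γ.re_μ_nonneg i
  have h4 : (0 : ℝ) ≤ n := n.cast_nonneg
  simp at h1
  linarith

theorem IsPoleFreeLine.eval_ne_zero {A : ℝ} (hA : γ.IsPoleFreeLine A) (t : ℝ) :
    0 < ‖γ.eval (-A + t * I)‖ := by
  rw [norm_eval]
  refine mul_pos (Real.rpow_pos_of_pos γ.Q_pos _) (Finset.prod_pos fun i _ => ?_)
  exact norm_pos_iff.2 (Gamma_ne_zero fun n => hA.arg_ne i t n)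

theorem IsAdmissible.norm_eq {F : ℂ → ℂ} (h : γ.IsAdmissible F) {A : ℝ} (hA0 : 0 < A)
    (hA : γ.IsPoleFreeLine A) (t : ℝ) :
    ‖γ.eval (-A + t * I)‖ * ‖F (-A + t * I)‖ =
      ‖γ.eval (1 + A + t * I)‖ * ‖F (1 + A + t * I)‖ := by
  have e : 1 - starRingEnd ℂ (-A + t * I : ℂ) = 1 + A + t * I := by
    simp only [map_add, map_neg, map_mul, conj_ofReal, conj_I]; ring
  have hre : (-A + t * I : ℂ).re = -A := by simp
  have h0 : (-A + t * I : ℂ) ≠ 0 := fun h => by rw [h] at hre; simp at hre; linarith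
  have h1 : (-A + t * I : ℂ) ≠ 1 := fun h => by rw [h] at hre; simp at hre; linarith
  have := h (-A + t * I) h0 h1 (fun ⟨i, n, hp⟩ => hA.arg_ne i t n hp)
    (by rw [e]; exact not_isPole_of_re_pos (by simp; linarith))
  have h2 := congrArg norm this
  rwa [RCLike.norm_conj, norm_mul, norm_mul, e] at h2

/-- The growth exponent on the line `Re s = -A` obtained by rounding up each Gamma quotient. -/
noncomputable def growthExponent (γ : GammaFactor) (A : ℝ) : ℕ :=
  ∑ i, ⌈γ.w i * (1 + 2 * A)⌉₊

/-- Only the slope in `A` matters, and it is the degree; the `k` ceilings cost at most one each. -/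
theorem growthExponent_le {A : ℝ} (hA : 0 ≤ A) :
    (γ.growthExponent A : ℝ) ≤ γ.degree * A + (γ.degree / 2 + γ.k) := by
  have h : ∀ i : Fin γ.k, (⌈γ.w i * (1 + 2 * A)⌉₊ : ℝ) ≤ γ.w i * (1 + 2 * A) + 1 := fun i =>
    (Nat.ceil_lt_add_one (mul_nonneg (γ.w_pos i).le (by linarith))).le
  rw [growthExponent, Nat.cast_sum]
  refine (Finset.sum_le_sum fun i _ => h i).trans (le_of_eq ?_)
  rw [Finset.sum_add_distrib, ← Finset.sum_mul, degree]
  simp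
  ring

theorem exists_prod_norm_add_le (i : Fin γ.k) {A : ℝ} (hA : 0 < A) (m : ℕ) :
    ∃ C : ℝ, 0 ≤ C ∧ ∀ t : ℝ, ∏ j ∈ Finset.range m, ‖(γ.w i : ℂ) * (-A + t * I) + γ.μ i + j‖ ≤
      C * (1 + |t|) ^ m := by
  set D : ℝ := γ.w i * A + γ.w i + ‖γ.μ i‖ + m with hD
  have hw := γ.w_pos i
  refine ⟨D ^ m, by positivity, fun t => ?_⟩
  rw [← mul_pow]
  have : ∀ j ∈ Finset.range m, ‖(γ.w i : ℂ) * (-A + t * I) + γ.μ i + j‖ ≤ D * (1 + |t|) := by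
    intro j hj
    have hj' : (j : ℝ) ≤ m := by exact_mod_cast (Finset.mem_range.1 hj).le
    have h1 : ‖(-A + t * I : ℂ)‖ ≤ A + |t| := by
      refine (norm_add_le _ _).trans ?_
      simp [abs_of_pos hA]
    have h2 : ‖(γ.w i : ℂ) * (-A + t * I)‖ ≤ γ.w i * (A + |t|) := by
      rw [norm_mul, norm_real, Real.norm_of_nonneg hw.le]
      gcongr
    have h3 := norm_add₃_le (a := (γ.w i : ℂ) * (-A + t * I)) (b := γ.μ i) (c := (j : ℂ))
    rw [Complex.norm_natCast] at h3
    have h4 : 0 ≤ (γ.w i * A + ‖γ.μ i‖ + m) * |t| := by positivity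
    rw [hD]
    nlinarith
  refine (Finset.prod_le_prod (fun _ _ => norm_nonneg _) this).trans ?_
  simp

theorem exists_norm_eval_le {A : ℝ} (hA0 : 0 < A) (hA : γ.IsPoleFreeLine A) :
    ∃ C : ℝ, 0 ≤ C ∧ ∀ t : ℝ, ‖γ.eval (1 + A + t * I)‖ ≤
      C * (1 + |t|) ^ γ.growthExponent A * ‖γ.eval (-A + t * I)‖ := by
  have hi : ∀ i : Fin γ.k, ∃ C : ℝ, 0 ≤ C ∧ ∀ t : ℝ,
      ‖Gamma ((γ.w i : ℂ) * (1 + A + t * I) + γ.μ i)‖ ≤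
        C * (1 + |t|) ^ ⌈γ.w i * (1 + 2 * A)⌉₊ * ‖Gamma ((γ.w i : ℂ) * (-A + t * I) + γ.μ i)‖ := by
    intro i
    have hw := γ.w_pos i
    have hμ := γ.re_μ_nonneg i
    obtain ⟨C₁, hC₁, h₁⟩ := exists_norm_Gamma_add_le (x := γ.w i * -A + (γ.μ i).re)
      (L := γ.w i * (1 + 2 * A)) (by nlinarith [mul_pos hw hA0])
    obtain ⟨C₂, hC₂, h₂⟩ := exists_prod_norm_add_le i hA0 ⌈γ.w i * (1 + 2 * A)⌉₊
    refine ⟨C₁ * C₂, by positivity, fun t => ?_⟩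
    rw [arg_reflect]
    refine (h₁ _ (arg_re i A t) (hA.arg_ne i t)).trans ?_
    rw [mul_assoc C₁, mul_assoc C₁]
    gcongr
    exact h₂ t
  choose C hC0 hC using hi
  have hQ := γ.Q_pos
  refine ⟨γ.Q ^ (1 + 2 * A) * ∏ i, C i,
    mul_nonneg (by positivity) (Finset.prod_nonneg fun i _ => hC0 i), fun t => ?_⟩
  rw [norm_eval, norm_eval]
  have e1 : (1 + A + t * I : ℂ).re = 1 + A := by simp
  have e2 : (-A + t * I : ℂ).re = -A := by simp
  rw [e1, e2]
  have e3 : γ.Q ^ (1 + A) = γ.Q ^ (1 + 2 * A) * γ.Q ^ (-A) := by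
    rw [← Real.rpow_add hQ]; congr 1; ring
  calc _ ≤ γ.Q ^ (1 + A) * ∏ i, (C i * (1 + |t|) ^ ⌈γ.w i * (1 + 2 * A)⌉₊ *
        ‖Gamma ((γ.w i : ℂ) * (-A + t * I) + γ.μ i)‖) := by
        gcongr with i
        exact hC i t
    _ = _ := by
        rw [Finset.prod_mul_distrib, Finset.prod_mul_distrib, Finset.prod_pow_eq_pow_sum, e3,
          growthExponent]
        ring

/-- The real shift `w i (1 + 2A)` exceeds `1`, so its floor leaves at least one factor `|z + j|`,
which is at least `Im z` and hence unbounded. -/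
theorem eventually_mul_norm_Gamma_le (i : Fin γ.k) {A : ℝ} (hA0 : 0 < A) (hwA : 1 < γ.w i * A)
    (hA : γ.IsPoleFreeLine A) (R : ℝ) :
    ∀ᶠ t : ℝ in atTop, R * ‖Gamma ((γ.w i : ℂ) * (-A + t * I) + γ.μ i)‖ ≤
      ‖Gamma ((γ.w i : ℂ) * (1 + A + t * I) + γ.μ i)‖ := by
  have hw := γ.w_pos i
  have hμ := γ.re_μ_nonneg i
  obtain ⟨c, hc, h⟩ := exists_le_norm_Gamma_add (x := γ.w i * -A + (γ.μ i).re)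
    (L := γ.w i * (1 + 2 * A)) (by positivity) (by nlinarith)
  set m := ⌊γ.w i * (1 + 2 * A)⌋₊ with hm
  have hm1 : m ≠ 0 := by
    rw [hm, Nat.ne_zero_iff_zero_lt, Nat.floor_pos]
    nlinarith
  have hlim : Tendsto (fun t : ℝ => γ.w i * t + (γ.μ i).im) atTop atTop :=
    tendsto_atTop_add_const_right _ _ (tendsto_id.const_mul_atTop hw)
  filter_upwards [hlim.eventually_ge_atTop 1, hlim.eventually_ge_atTop (R / c)] with t h1 h2
  rw [arg_reflect]
  refine le_trans ?_ (h _ (arg_re i A t) (hA.arg_ne i t))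
  rw [← mul_assoc]
  gcongr
  set x := γ.w i * t + (γ.μ i).im with hx
  have hj : ∀ j ∈ Finset.range m, x ≤ ‖(γ.w i : ℂ) * (-A + t * I) + γ.μ i + j‖ := by
    intro j _
    refine le_trans (le_of_eq ?_) ((le_abs_self _).trans (abs_im_le_norm _))
    rw [add_im, arg_im, natCast_im, add_zero]
  have hp : x ^ m ≤ ∏ j ∈ Finset.range m, ‖(γ.w i : ℂ) * (-A + t * I) + γ.μ i + j‖ := by
    have := Finset.prod_le_prod (s := Finset.range m) (f := fun _ => x)
      (fun _ _ => zero_le_one.trans h1) hj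
    simpa using this
  have hx1 : x ≤ x ^ m := le_self_pow₀ h1 hm1
  rw [div_le_iff₀ hc] at h2
  nlinarith

theorem eventually_mul_norm_eval_le (hk : 0 < γ.k) {A : ℝ} (hA0 : 0 < A)
    (hwA : ∀ i, 1 < γ.w i * A) (hA : γ.IsPoleFreeLine A) (R : ℝ) :
    ∀ᶠ t : ℝ in atTop, R * ‖γ.eval (-A + t * I)‖ ≤ ‖γ.eval (1 + A + t * I)‖ := by
  have hQ := γ.Q_pos
  have hQ' : 0 < γ.Q ^ (1 + 2 * A) := Real.rpow_pos_of_pos hQ _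
  -- Taking `R' ≥ 1` ensures `R' ≤ R' ^ k` for `k > 0`, so bounding every factor by `R'` suffices.
  set R' := max (R / γ.Q ^ (1 + 2 * A)) 1 with hR'
  have hall := eventually_all.2 fun i => eventually_mul_norm_Gamma_le i hA0 (hwA i) hA R'
  filter_upwards [hall] with t ht
  rw [norm_eval, norm_eval]
  have e1 : (1 + A + t * I : ℂ).re = 1 + A := by simp
  have e2 : (-A + t * I : ℂ).re = -A := by simp
  have e3 : γ.Q ^ (1 + A) = γ.Q ^ (1 + 2 * A) * γ.Q ^ (-A) := by
    rw [← Real.rpow_add hQ]; congr 1; ring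
  rw [e1, e2, e3]
  have h1 : (1 : ℝ) ≤ R' := le_max_right _ _
  have hP : R' * ∏ i, ‖Gamma ((γ.w i : ℂ) * (-A + t * I) + γ.μ i)‖ ≤
      ∏ i, ‖Gamma ((γ.w i : ℂ) * (1 + A + t * I) + γ.μ i)‖ := by
    have h2 := Finset.prod_le_prod (s := Finset.univ)
      (f := fun i => R' * ‖Gamma ((γ.w i : ℂ) * (-A + t * I) + γ.μ i)‖)
      (fun i _ => by positivity) (fun i _ => ht i)
    rw [Finset.prod_mul_distrib, Finset.prod_const, Finset.card_univ, Fintype.card_fin] at h2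
    refine le_trans ?_ h2
    gcongr
    · exact le_self_pow₀ h1 hk.ne'
  have hR : R ≤ γ.Q ^ (1 + 2 * A) * R' := by
    rw [mul_comm, ← div_le_iff₀ hQ']
    exact le_max_left _ _
  have hQA : 0 < γ.Q ^ (-A) := Real.rpow_pos_of_pos hQ _
  calc R * (γ.Q ^ (-A) * ∏ i, ‖Gamma ((γ.w i : ℂ) * (-A + t * I) + γ.μ i)‖)
      ≤ (γ.Q ^ (1 + 2 * A) * R') *
        (γ.Q ^ (-A) * ∏ i, ‖Gamma ((γ.w i : ℂ) * (-A + t * I) + γ.μ i)‖) := by gcongr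
    _ = γ.Q ^ (1 + 2 * A) * γ.Q ^ (-A) *
        (R' * ∏ i, ‖Gamma ((γ.w i : ℂ) * (-A + t * I) + γ.μ i)‖) := by ring
    _ ≤ _ := by gcongr

end GammaFactor

/-! ### Cancelling the pole at `1` within Dirichlet series -/

theorem HasAnalyticity.eq_div {F G : ℂ → ℂ} {m : ℕ} (h : ∀ s, s ≠ 1 → (s - 1) ^ m * F s = G s)
    {s : ℂ} (hs : s ≠ 1) : F s = G s / (s - 1) ^ m := by
  rw [← h s hs, mul_div_cancel_left₀ _ (pow_ne_zero m (sub_ne_zero.2 hs))]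

/-- The entire function `(1 - 2 ^ (1 - s)) / (s - 1)`. -/
noncomputable def etaFactor : ℂ → ℂ := dslope (fun s => 1 - (2 : ℂ) ^ (1 - s)) 1

theorem sub_one_mul_etaFactor (s : ℂ) : (s - 1) * etaFactor s = 1 - (2 : ℂ) ^ (1 - s) := by
  have := sub_smul_dslope (fun s : ℂ => 1 - (2 : ℂ) ^ (1 - s)) 1 s
  rw [smul_eq_mul] at this
  rw [etaFactor, this]
  simp

theorem differentiable_etaFactor : Differentiable ℂ etaFactor := by
  rw [← differentiableOn_univ, etaFactor, Complex.differentiableOn_dslope univ_mem,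
    differentiableOn_univ]
  refine (differentiable_const _).sub (Differentiable.const_cpow (by fun_prop) (Or.inl two_ne_zero))

theorem norm_two_cpow_one_sub (s : ℂ) : ‖(2 : ℂ) ^ (1 - s)‖ = 2 ^ (1 - s.re) := by
  have := norm_cpow_eq_rpow_re_of_pos (two_pos : (0 : ℝ) < 2) (1 - s)
  simpa using this

theorem hasFiniteOrderInStrips_etaFactor_pow_mul {G : ℂ → ℂ} (hG : IsEntireOfFiniteOrder G) (m : ℕ) :
    HasFiniteOrderInStrips fun s => etaFactor s ^ m * G s := by
  obtain ⟨-, ρ, hρ⟩ := hG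
  intro a b
  refine ⟨ρ, IsBigO.trans (IsBigO.of_bound ((1 + 2 ^ (1 - a)) ^ m) ?_) (hρ.mono inf_le_left)⟩
  have hfar : ∀ᶠ s : ℂ in Bornology.cobounded ℂ, 2 ≤ ‖s‖ :=
    tendsto_norm_cobounded_atTop.eventually_ge_atTop 2
  filter_upwards [mem_inf_of_left hfar, mem_inf_of_right (mem_principal_self _)] with s h2 hs
  rw [norm_mul, norm_pow]
  gcongr
  have h1 : 1 ≤ ‖s - 1‖ := by
    have := norm_sub_norm_le s 1
    rw [norm_one] at this
    linarith
  have h3 := congrArg norm (sub_one_mul_etaFactor s)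
  rw [norm_mul] at h3
  calc ‖etaFactor s‖ ≤ ‖s - 1‖ * ‖etaFactor s‖ := le_mul_of_one_le_left (norm_nonneg _) h1
    _ = ‖1 - (2 : ℂ) ^ (1 - s)‖ := h3
    _ ≤ ‖(1 : ℂ)‖ + ‖(2 : ℂ) ^ (1 - s)‖ := norm_sub_le _ _
    _ ≤ 1 + 2 ^ (1 - a) := by
        rw [norm_one, norm_two_cpow_one_sub]
        have : 1 - s.re ≤ 1 - a := by linarith [hs.1]
        gcongr
        norm_num

/-- Coefficients of the Dirichlet series `1 - 2 ^ (1 - s)`. -/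
def etaCoeff (n : ℕ) : ℂ := if n = 1 then 1 else if n = 2 then -2 else 0

theorem LSeriesHasSum_etaCoeff (s : ℂ) : LSeriesHasSum etaCoeff s (1 - (2 : ℂ) ^ (1 - s)) := by
  have h : LSeriesHasSum etaCoeff s (∑ n ∈ ({1, 2} : Finset ℕ), LSeries.term etaCoeff s n) := by
    refine hasSum_sum_of_ne_finset_zero fun n hn => ?_
    simp only [Finset.mem_insert, Finset.mem_singleton, not_or] at hn
    simp [LSeries.term_def, etaCoeff, hn.1, hn.2]
  have e : ∑ n ∈ ({1, 2} : Finset ℕ), LSeries.term etaCoeff s n = 1 - (2 : ℂ) ^ (1 - s) := by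
    rw [Finset.sum_pair (by norm_num), LSeries.term_of_ne_zero one_ne_zero,
      LSeries.term_of_ne_zero two_ne_zero, cpow_sub _ _ two_ne_zero]
    simp [etaCoeff]
    ring
  rwa [e] at h

theorem exists_LSeriesHasSum_eta_pow_mul {F : ℂ → ℂ} {a : ℕ → ℂ}
    (ha : ∀ s : ℂ, 1 < s.re → LSeriesHasSum a s (F s)) (m : ℕ) :
    ∃ a' : ℕ → ℂ, ∀ s : ℂ, 1 < s.re → LSeriesHasSum a' s ((1 - (2 : ℂ) ^ (1 - s)) ^ m * F s) := by
  induction m with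
  | zero => exact ⟨a, fun s hs => by simpa using ha s hs⟩
  | succ m ih =>
    obtain ⟨a', h⟩ := ih
    refine ⟨LSeries.convolution etaCoeff a', fun s hs => ?_⟩
    rw [pow_succ', mul_assoc]
    exact (LSeriesHasSum_etaCoeff s).convolution (h s hs)

/-! ### Degree less than one: rapid decay of coefficients, and no Gamma functions -/

theorem isBigO_sq_mul_exp_neg_rpow (B : ℝ) {δ : ℝ} (hδ : 0 < δ) (S : ℝ) :
    (fun n : ℕ => (n : ℝ) ^ 2 * Real.exp (-(((n : ℝ) ^ (1 + δ)) ^ 2 / (8 * (n : ℝ) ^ 2))) * S)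
      =O[atTop] fun n : ℕ => (n : ℝ) ^ (-B) := by
  have hx : Tendsto (fun n : ℕ => (n : ℝ) ^ (2 * δ)) atTop atTop :=
    (tendsto_rpow_atTop (by positivity)).comp tendsto_natCast_atTop_atTop
  have hlo := (isLittleO_rpow_exp_pos_mul_atTop ((2 + B) / (2 * δ))
    (show (0 : ℝ) < 1 / 8 by norm_num)).bound (show (0 : ℝ) < 1 by norm_num)
  refine IsBigO.of_bound |S| ?_
  filter_upwards [hx.eventually hlo, eventually_gt_atTop 0] with n hn hn0
  have hn' : (0 : ℝ) < n := by exact_mod_cast hn0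
  rw [Real.norm_of_nonneg (by positivity), Real.norm_of_nonneg (by positivity), one_mul,
    ← Real.rpow_mul hn'.le, mul_div_cancel₀ _ (by positivity)] at hn
  have e : ((n : ℝ) ^ (1 + δ)) ^ 2 / (8 * (n : ℝ) ^ 2) = 1 / 8 * (n : ℝ) ^ (2 * δ) := by
    rw [← Real.rpow_natCast, ← Real.rpow_mul hn'.le,
      show (1 + δ) * ((2 : ℕ) : ℝ) = 2 * δ + 2 by push_cast; ring, Real.rpow_add hn']
    norm_num
    field_simp
  rw [e, norm_mul, mul_comm, Real.norm_eq_abs S, Real.norm_of_nonneg (by positivity),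
    Real.norm_of_nonneg (by positivity)]
  gcongr
  rw [Real.exp_neg, ← div_eq_mul_inv, div_le_iff₀ (Real.exp_pos _)]
  refine le_trans (le_of_eq ?_) (mul_le_mul_of_nonneg_left hn (by positivity : 0 ≤ (n : ℝ) ^ (-B)))
  rw [← Real.rpow_add hn', ← Real.rpow_natCast]
  congr 1
  push_cast
  ring

/-- Choose `T = n^(1+δ)` in `norm_coeff_le`: the off-diagonal weight becomes `exp (-n^(2δ)/8)`, and
the shifted integral contributes `n^(-A + (1+δ)κ)`. -/
theorem isBigO_coeff_of_growth {H : ℂ → ℂ} (hH : HasFiniteOrderInStrips H)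
    (hd : Differentiable ℂ H) {a : ℕ → ℂ} (ha : ∀ s : ℂ, 1 < s.re → LSeriesHasSum a s (H s))
    {A C : ℝ} (hA : 0 ≤ A) {κ : ℕ} (hle : ∀ t : ℝ, ‖H (-A + t * I)‖ ≤ C * (1 + |t|) ^ κ)
    {B δ : ℝ} (hδ : 0 < δ) (hB : -A + (1 + δ) * κ ≤ -B) :
    a =O[atTop] fun n : ℕ => (n : ℝ) ^ (-B) := by
  have hC : 0 ≤ C := by simpa using (norm_nonneg _).trans (hle 0)
  set S : ℝ := ∑' n, ‖LSeries.term a 2 n‖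
  set D : ℝ := C * Real.exp ((A + 2) ^ 2 / 2) * gaussianMoment κ with hD
  have h2 : (fun n : ℕ => D * (n : ℝ) ^ (-B)) =O[atTop] fun n : ℕ => (n : ℝ) ^ (-B) :=
    (isBigO_refl _ _).const_mul_left D
  refine IsBigO.trans (IsBigO.of_bound 1 ?_) ((isBigO_sq_mul_exp_neg_rpow B hδ S).add h2)
  filter_upwards [eventually_gt_atTop 0] with n hn
  have hn' : (0 : ℝ) < n := by exact_mod_cast hn
  have hn1 : (1 : ℝ) ≤ n := by exact_mod_cast hn
  have hT : 1 ≤ (n : ℝ) ^ (1 + δ) := Real.one_le_rpow hn1 (by linarith)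
  have h := norm_coeff_le hH hd ha hA hle hn.ne' hT
  rw [one_mul]
  refine h.trans (le_trans ?_ (le_abs_self _))
  refine add_le_add le_rfl ?_
  have e1 : ((n : ℝ) ^ (1 + δ)) ^ κ = (n : ℝ) ^ ((1 + δ) * κ) := by
    rw [← Real.rpow_natCast, ← Real.rpow_mul hn'.le]
  have e2 : Real.exp ((A + 2) ^ 2 / (2 * ((n : ℝ) ^ (1 + δ)) ^ 2)) ≤ Real.exp ((A + 2) ^ 2 / 2) := by
    rw [Real.exp_le_exp]
    refine div_le_div_of_nonneg_left (by positivity) (by norm_num) ?_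
    have : 1 ≤ ((n : ℝ) ^ (1 + δ)) ^ 2 := one_le_pow₀ hT
    linarith
  have e3 : (n : ℝ) ^ (-A) * (n : ℝ) ^ ((1 + δ) * κ) ≤ (n : ℝ) ^ (-B) := by
    rw [← Real.rpow_add hn']
    exact Real.rpow_le_rpow_of_exponent_le hn1 hB
  have hJ := gaussianMoment_nonneg κ
  rw [e1]
  calc C * (n : ℝ) ^ (-A) * Real.exp ((A + 2) ^ 2 / (2 * ((n : ℝ) ^ (1 + δ)) ^ 2)) *
        ((n : ℝ) ^ ((1 + δ) * κ) * gaussianMoment κ)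
      ≤ C * (n : ℝ) ^ (-A) * Real.exp ((A + 2) ^ 2 / 2) *
        ((n : ℝ) ^ ((1 + δ) * κ) * gaussianMoment κ) := by gcongr
    _ = D * ((n : ℝ) ^ (-A) * (n : ℝ) ^ ((1 + δ) * κ)) := by rw [hD]; ring
    _ ≤ _ := by
      have : 0 ≤ D := by positivity
      gcongr

theorem eq_LSeries_of_forall_LSeriesSummable {H : ℂ → ℂ} (hd : Differentiable ℂ H) {a : ℕ → ℂ}
    (ha : ∀ s : ℂ, 1 < s.re → LSeriesHasSum a s (H s)) (hs : ∀ s, LSeriesSummable a s) :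
    H = LSeries a := by
  have hU : ∀ s : ℂ, s ∈ {s : ℂ | LSeries.abscissaOfAbsConv a < s.re} := by
    intro s
    refine lt_of_le_of_lt (hs ((s.re - 1 : ℝ) : ℂ)).abscissaOfAbsConv_le ?_
    rw [ofReal_re]
    exact_mod_cast sub_one_lt s.re
  have hL : AnalyticOnNhd ℂ (LSeries a) Set.univ := fun s _ => LSeries_analyticOnNhd a s (hU s)
  have hHa : AnalyticOnNhd ℂ H Set.univ := fun s _ => hd.analyticAt s
  refine hHa.eq_of_eventuallyEq hL (z₀ := 2) ?_
  have : {s : ℂ | 1 < s.re} ∈ 𝓝 (2 : ℂ) :=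
    (isOpen_lt continuous_const continuous_re).mem_nhds (by simp)
  filter_upwards [this] with s hs
  exact (ha s hs).LSeries_eq.symm

theorem exists_norm_vertical_le_tsum {F : ℂ → ℂ} {a : ℕ → ℂ}
    (ha : ∀ s : ℂ, 1 < s.re → LSeriesHasSum a s (F s)) {A : ℝ} (hA : 0 < A) :
    ∀ t : ℝ, ‖F (1 + A + t * I)‖ ≤ ∑' n, ‖LSeries.term a (1 + A) n‖ := by
  intro t
  rw [← (ha (1 + A + t * I) (by simpa)).LSeries_eq]
  have hn : ∀ n, ‖LSeries.term a (1 + A + t * I) n‖ = ‖LSeries.term a (1 + A) n‖ := by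
    intro n; simp [LSeries.norm_term_eq]
  refine (norm_tsum_le_tsum_norm ?_).trans (le_of_eq (tsum_congr hn))
  exact (ha (1 + A + t * I) (by simpa)).LSeriesSummable.norm

theorem GammaFactor.degree_nonneg (γ : GammaFactor) : 0 ≤ γ.degree :=
  mul_nonneg zero_le_two (Finset.sum_nonneg fun i _ => (γ.w_pos i).le)

theorem GammaFactor.IsAdmissible.exists_norm_le {γ : GammaFactor} {F : ℂ → ℂ}
    (hγ : γ.IsAdmissible F) {a : ℕ → ℂ} (ha : ∀ s : ℂ, 1 < s.re → LSeriesHasSum a s (F s))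
    {A : ℝ} (hA0 : 0 < A) (hA : γ.IsPoleFreeLine A) :
    ∃ C : ℝ, 0 ≤ C ∧ ∀ t : ℝ, ‖F (-A + t * I)‖ ≤ C * (1 + |t|) ^ γ.growthExponent A := by
  obtain ⟨C, hC0, hC⟩ := GammaFactor.exists_norm_eval_le hA0 hA
  set S := ∑' n, ‖LSeries.term a (1 + A) n‖ with hS
  have hS0 : 0 ≤ S := tsum_nonneg fun _ => norm_nonneg _
  refine ⟨C * S, by positivity, fun t => ?_⟩
  have hpos := hA.eval_ne_zero t
  refine le_of_mul_le_mul_left ?_ hpos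
  rw [hγ.norm_eq hA0 hA]
  calc ‖γ.eval (1 + A + t * I)‖ * ‖F (1 + A + t * I)‖
      ≤ (C * (1 + |t|) ^ γ.growthExponent A * ‖γ.eval (-A + t * I)‖) * S := by
        gcongr
        · exact hC t
        · exact exists_norm_vertical_le_tsum ha hA0 t
    _ = _ := by ring

theorem exists_norm_le_of_degree_lt_one {γ : GammaFactor} {F : ℂ → ℂ} (hF : HasAnalyticity F)
    (hγ : γ.IsAdmissible F) (hdeg : γ.degree < 1) {a : ℕ → ℂ}
    (ha : ∀ s : ℂ, 1 < s.re → LSeriesHasSum a s (F s)) {A' : ℝ} (hA' : 0 < A') :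
    ∃ M : ℝ, ∀ t : ℝ, ‖F (-A' + t * I)‖ ≤ M := by
  obtain ⟨⟨m, G, hG, hFG⟩, -⟩ := hF
  obtain ⟨a', ha'⟩ := exists_LSeriesHasSum_eta_pow_mul ha m
  set H : ℂ → ℂ := fun s => etaFactor s ^ m * G s with hH
  have hHF : ∀ s, s ≠ 1 → H s = (1 - (2 : ℂ) ^ (1 - s)) ^ m * F s := by
    intro s hs
    simp only [hH]
    rw [← hFG s hs, ← sub_one_mul_etaFactor, mul_pow]
    ring
  have hHd : Differentiable ℂ H := (differentiable_etaFactor.pow m).mul hG.1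
  have hHs : HasFiniteOrderInStrips H := hasFiniteOrderInStrips_etaFactor_pow_mul hG m
  have haH : ∀ s : ℂ, 1 < s.re → LSeriesHasSum a' s (H s) := by
    intro s hs
    rw [hHF s (fun h => by rw [h] at hs; simp at hs)]
    exact ha' s hs
  have hne : ∀ (A t : ℝ), 0 < A → (-A + t * I : ℂ) ≠ 1 := by
    intro A t hA h
    have := congrArg re h
    simp at this
    linarith
  have hcoef : ∀ B : ℝ, a' =O[atTop] fun n : ℕ => (n : ℝ) ^ (-B) := by
    intro B
    set d := γ.degree with hd
    have hd0 : 0 ≤ d := γ.degree_nonneg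
    -- With this `δ`, `q = (1 - d)(1 - d/2) > 0`: the exponent `-A + (1+δ)κ` falls at least like
    -- `-qA` up to a constant, and `A` is taken large enough to push it below `-B`.
    set δ : ℝ := (1 - d) / 2 with hδ
    have hδ0 : 0 < δ := by rw [hδ]; linarith
    set q : ℝ := 1 - (1 + δ) * d with hq
    have hq0 : 0 < q := by rw [hq, hδ]; nlinarith
    obtain ⟨A, hAB, hA⟩ := γ.exists_isPoleFreeLine_gt
      (max 0 ((B + (1 + δ) * (d / 2 + γ.k)) / q))
    have hA0 : 0 < A := (le_max_left _ _).trans_lt hAB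
    have hA1 := ((le_max_right _ _).trans_lt hAB).le
    rw [div_le_iff₀ hq0] at hA1
    obtain ⟨C, hC0, hC⟩ := hγ.exists_norm_le ha hA0 hA
    refine isBigO_coeff_of_growth hHs hHd haH hA0.le (κ := γ.growthExponent A)
      (C := (1 + 2 ^ (1 + A)) ^ m * C) (fun t => ?_) hδ0 ?_
    · rw [hHF _ (hne A t hA0), norm_mul, norm_pow, mul_assoc]
      gcongr
      · refine (norm_sub_le _ _).trans (le_of_eq ?_)
        rw [norm_one, norm_two_cpow_one_sub]
        simp
      · exact hC t
    · have h1 := GammaFactor.growthExponent_le (γ := γ) hA0.le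
      have h2 := mul_le_mul_of_nonneg_left h1 (show 0 ≤ 1 + δ by linarith)
      rw [← hd] at h2
      nlinarith
  have hsum : ∀ s, LSeriesSummable a' s := fun s =>
    LSeriesSummable_of_isBigO_rpow (x := s.re - 1) (by linarith) (by
      have := hcoef (-(s.re - 1 - 1))
      rwa [neg_neg] at this)
  have hHL := eq_LSeries_of_forall_LSeriesSummable hHd haH hsum
  refine ⟨(∑' n, ‖LSeries.term a' (-A') n‖) / (2 ^ (1 + A') - 1) ^ m, fun t => ?_⟩
  -- On `Re s = -A'` one has `|2^(1-s)| = 2^(1+A') > 1`, so the auxiliary factor can be divided out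
  -- with a uniform loss.
  have h2 : 0 < (2 : ℝ) ^ (1 + A') - 1 := by
    have := Real.one_lt_rpow (one_lt_two (α := ℝ)) (show 0 < 1 + A' by linarith)
    linarith
  rw [le_div_iff₀ (pow_pos h2 m)]
  have hb : ‖H (-A' + t * I)‖ ≤ ∑' n, ‖LSeries.term a' (-A') n‖ := by
    rw [hHL]
    have hn : ∀ n, ‖LSeries.term a' (-A' + t * I) n‖ = ‖LSeries.term a' (-A') n‖ := by
      intro n; simp [LSeries.norm_term_eq]
    exact (norm_tsum_le_tsum_norm (hsum _).norm).trans (le_of_eq (tsum_congr hn))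
  rw [hHF _ (hne A' t hA'), norm_mul, norm_pow, mul_comm] at hb
  refine le_trans ?_ hb
  gcongr
  have := norm_sub_norm_le ((2 : ℂ) ^ (1 - (-A' + t * I) : ℂ)) 1
  rw [norm_sub_rev, norm_one, norm_two_cpow_one_sub] at this
  simpa using this

theorem HasEulerProduct.exists_pos_le_norm {F : ℂ → ℂ} (hF : HasEulerProduct F) {A : ℝ}
    (hA : 0 < A) : ∃ c : ℝ, 0 < c ∧ ∀ t : ℝ, c ≤ ‖F (1 + A + t * I)‖ := by
  obtain ⟨b, -, -, hb⟩ := hF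
  refine ⟨Real.exp (-∑' n, ‖LSeries.term b (1 + A) n‖), Real.exp_pos _, fun t => ?_⟩
  obtain ⟨L, hL, hLF⟩ := hb (1 + A + t * I) (by simpa)
  rw [← hLF, norm_exp, Real.exp_le_exp]
  have hn : ∀ n, ‖LSeries.term b (1 + A + t * I) n‖ = ‖LSeries.term b (1 + A) n‖ := by
    intro n; simp [LSeries.norm_term_eq]
  have h : ‖L‖ ≤ ∑' n, ‖LSeries.term b (1 + A) n‖ := by
    rw [← hL.LSeries_eq]
    exact (norm_tsum_le_tsum_norm hL.LSeriesSummable.norm).trans (le_of_eq (tsum_congr hn))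
  have := neg_abs_le L.re
  have := abs_re_le_norm L
  linarith

/-- An admissible gamma factor of degree less than one has no Gamma functions at all. -/
theorem GammaFactor.IsAdmissible.k_eq_zero {γ : GammaFactor} {F : ℂ → ℂ} (hF : F ∈ SelbergClass)
    (hγ : γ.IsAdmissible F) (hdeg : γ.degree < 1) : γ.k = 0 := by
  obtain ⟨hF1, ⟨a, -, -, ha⟩, -, hF4⟩ := hF
  by_contra hk
  -- Exceeding the sum of the `1 / w i` gives `w i * A > 1` for all `i` at once.
  obtain ⟨A, hAB, hA⟩ := γ.exists_isPoleFreeLine_gt (∑ i, 1 / γ.w i)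
  have hnn : ∀ i, 0 ≤ 1 / γ.w i := fun i => (one_div_pos.2 (γ.w_pos i)).le
  have hA0 : 0 < A := (Finset.sum_nonneg fun i _ => hnn i).trans_lt hAB
  have hwA : ∀ i, 1 < γ.w i * A := by
    intro i
    have h := (Finset.single_le_sum (fun i _ => hnn i) (Finset.mem_univ i)).trans_lt hAB
    rwa [div_lt_iff₀ (γ.w_pos i), mul_comm] at h
  obtain ⟨M, hM⟩ := exists_norm_le_of_degree_lt_one hF1 hγ hdeg ha hA0
  obtain ⟨c, hc, hcF⟩ := hF4.exists_pos_le_norm hA0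
  -- A Gamma quotient of at least `(M + 1) / c` forces `|F(-A + it)| ≥ M + 1`, against the bound
  -- `M`.
  obtain ⟨t, ht⟩ := (GammaFactor.eventually_mul_norm_eval_le (Nat.pos_of_ne_zero hk) hA0 hwA hA
    ((M + 1) / c)).exists
  have hpos := hA.eval_ne_zero t
  have hM0 : 0 ≤ M := (norm_nonneg _).trans (hM t)
  have h1 := hγ.norm_eq hA0 hA t
  have h2 : (M + 1) * ‖γ.eval (-A + t * I)‖ ≤ ‖γ.eval (-A + t * I)‖ * ‖F (-A + t * I)‖ := by
    rw [h1]
    calc _ = (M + 1) / c * ‖γ.eval (-A + t * I)‖ * c := by field_simp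
      _ ≤ _ := by
        gcongr
        exact hcF t
  nlinarith [hM t]

/-! ### Gamma factors `ε Q^s`: `F` is an entire Dirichlet polynomial -/

namespace GammaFactor

variable {γ : GammaFactor}

theorem norm_eval_of_k_eq_zero (hk : γ.k = 0) (s : ℂ) : ‖γ.eval s‖ = γ.Q ^ s.re := by
  have : IsEmpty (Fin γ.k) := by rw [hk]; infer_instance
  rw [norm_eval, Finset.univ_eq_empty, Finset.prod_empty, mul_one]

theorem not_isPole_of_k_eq_zero (hk : γ.k = 0) (s : ℂ) : ¬ γ.IsPole s := by
  rintro ⟨i, -⟩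
  exact absurd i.2 (by simp [hk])

theorem IsAdmissible.norm_eq_of_k_eq_zero {F : ℂ → ℂ} (hγ : γ.IsAdmissible F) (hk : γ.k = 0)
    {s : ℂ} (h0 : s ≠ 0) (h1 : s ≠ 1) :
    ‖F s‖ = γ.Q ^ (1 - 2 * s.re) * ‖F (1 - starRingEnd ℂ s)‖ := by
  have h := congrArg norm (hγ s h0 h1 (not_isPole_of_k_eq_zero hk _) (not_isPole_of_k_eq_zero hk _))
  rw [RCLike.norm_conj, norm_mul, norm_mul, norm_eval_of_k_eq_zero hk,
    norm_eval_of_k_eq_zero hk] at h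
  have hQ := Real.rpow_pos_of_pos γ.Q_pos s.re
  refine mul_left_cancel₀ hQ.ne' (h.trans ?_)
  rw [← mul_assoc, ← Real.rpow_add γ.Q_pos]
  congr 2
  simp
  ring

theorem IsAdmissible.differentiable_of_k_eq_zero {F : ℂ → ℂ} (hF : HasAnalyticity F)
    (hγ : γ.IsAdmissible F) (hk : γ.k = 0) : Differentiable ℂ F := by
  obtain ⟨⟨m, G, hG, hFG⟩, hone⟩ := hF
  have hd : ∀ s, s ≠ 1 → DifferentiableAt ℂ F s := by
    intro s hs
    have : F =ᶠ[𝓝 s] fun s => G s / (s - 1) ^ m := by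
      filter_upwards [isOpen_ne.mem_nhds hs] with z hz using HasAnalyticity.eq_div hFG hz
    refine DifferentiableAt.congr_of_eventuallyEq ?_ this
    exact (hG.1 s).div (by fun_prop) (pow_ne_zero _ (sub_ne_zero.2 hs))
  have hcont : ContinuousAt F 1 := by
    -- The reflection of `1` is `0`, where `F` is regular, so the functional equation bounds `|F|`
    -- near `1` and excludes a pole.
    refine hone.resolve_right fun hinf => ?_
    have hlim : Tendsto (fun s : ℂ => γ.Q ^ (1 - 2 * s.re) * ‖F (1 - starRingEnd ℂ s)‖) (𝓝[≠] 1)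
        (𝓝 (γ.Q ^ (1 - 2 * (1 : ℂ).re) * ‖F (1 - starRingEnd ℂ 1)‖)) := by
      refine Tendsto.mono_left ?_ nhdsWithin_le_nhds
      refine Tendsto.mul ?_ (Tendsto.norm ?_)
      · exact (Continuous.tendsto (Real.continuous_const_rpow γ.Q_pos.ne' |>.comp
          (by fun_prop : Continuous fun s : ℂ => 1 - 2 * s.re)) 1)
      · have hc : ContinuousAt F (1 - starRingEnd ℂ 1) := (hd _ (by simp)).continuousAt
        exact hc.tendsto.comp (Continuous.tendsto (continuous_const.sub continuous_conj) 1)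
    have h0 : ∀ᶠ s : ℂ in 𝓝[≠] 1, s ≠ 0 :=
      nhdsWithin_le_nhds (isOpen_ne.mem_nhds one_ne_zero)
    refine not_tendsto_nhds_of_tendsto_atTop (tendsto_norm_atTop_iff_cobounded.2 hinf) _
      (hlim.congr' ?_)
    filter_upwards [h0, self_mem_nhdsWithin] with s h0 h1
    exact (hγ.norm_eq_of_k_eq_zero hk h0 h1).symm
  rw [← differentiableOn_univ, ← differentiableOn_compl_singleton_and_continuousAt_iff
    (c := 1) univ_mem]
  exact ⟨fun s hs => (hd s (by simpa using hs)).differentiableWithinAt, hcont⟩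

theorem IsAdmissible.norm_functional_equation {F : ℂ → ℂ} (hd : Differentiable ℂ F)
    (hγ : γ.IsAdmissible F) (hk : γ.k = 0) (s : ℂ) :
    ‖F s‖ = γ.Q ^ (1 - 2 * s.re) * ‖F (1 - starRingEnd ℂ s)‖ := by
  have hdense : Dense ({0, 1}ᶜ : Set ℂ) := (Set.toFinite {0, 1}).countable.dense_compl ℝ
  refine congrFun (Continuous.ext_on hdense (f := fun s => ‖F s‖)
    (g := fun s : ℂ => γ.Q ^ (1 - 2 * s.re) * ‖F (1 - starRingEnd ℂ s)‖) ?_ ?_ ?_) s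
  · exact hd.continuous.norm
  · refine Continuous.mul ?_ (Continuous.norm ?_)
    · exact Real.continuous_const_rpow γ.Q_pos.ne' |>.comp
        (by fun_prop : Continuous fun s : ℂ => 1 - 2 * s.re)
    · exact hd.continuous.comp (continuous_const.sub continuous_conj)
  · intro z hz
    simp only [Set.mem_compl_iff, Set.mem_insert_iff, Set.mem_singleton_iff, not_or] at hz
    exact hγ.norm_eq_of_k_eq_zero hk hz.1 hz.2

end GammaFactor

theorem HasAnalyticity.hasFiniteOrderInStrips {F : ℂ → ℂ} (hF : HasAnalyticity F) :
    HasFiniteOrderInStrips F := by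
  obtain ⟨⟨m, G, ⟨-, ρ, hρ⟩, hFG⟩, -⟩ := hF
  intro a b
  refine ⟨ρ, IsBigO.mono (IsBigO.trans (IsBigO.of_bound 1 ?_) hρ) inf_le_left⟩
  filter_upwards [tendsto_norm_cobounded_atTop.eventually_ge_atTop (2 : ℝ)] with s hs
  have h1 : 1 ≤ ‖s - 1‖ := by
    have := norm_sub_norm_le s 1
    rw [norm_one] at this
    linarith
  have hs1 : s ≠ 1 := by
    rintro rfl
    norm_num at h1
  rw [← hFG s hs1, norm_mul, norm_pow, one_mul]
  exact le_mul_of_one_le_left (norm_nonneg _) (one_le_pow₀ h1)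

/-- Without Gamma functions `F` is bounded on `Re s = -A`, so `κ = 0` and `T → ∞` is allowed for
fixed `N`. What remains is `|a N| ≤ Q^(1+2A) S N^(-A)`, which tends to `0` as `A → ∞` when `N >
Q^2`. -/
theorem coeff_eq_zero_of_sq_lt {γ : GammaFactor} {F : ℂ → ℂ} (hF : HasAnalyticity F)
    (hγ : γ.IsAdmissible F) (hk : γ.k = 0) {a : ℕ → ℂ}
    (ha : ∀ s : ℂ, 1 < s.re → LSeriesHasSum a s (F s)) {N : ℕ} (hN : γ.Q ^ 2 < N) : a N = 0 := by
  have hd := hγ.differentiable_of_k_eq_zero hF hk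
  have hQ := γ.Q_pos
  have hNr : (0 : ℝ) < N := (by positivity : 0 < γ.Q ^ 2).trans hN
  have hN0 : N ≠ 0 := by rintro rfl; simp at hNr
  set S : ℝ := ∑' n, ‖LSeries.term a 2 n‖ with hS
  have hsum2 : LSeriesSummable a 2 := (ha 2 (by simp)).LSeriesSummable
  have hstep : ∀ j : ℕ, ‖a N‖ ≤ γ.Q ^ 3 * S / N * (γ.Q ^ 2 / N) ^ j := by
    intro j
    set A : ℝ := j + 1 with hA
    have hA1 : 1 ≤ A := by rw [hA]; simp
    have hle : ∀ t : ℝ, ‖F (-A + t * I)‖ ≤ γ.Q ^ (1 + 2 * A) * S * (1 + |t|) ^ 0 := by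
      intro t
      rw [hγ.norm_functional_equation hd hk, pow_zero, mul_one]
      have e : 1 - starRingEnd ℂ (-A + t * I : ℂ) = 1 + A + t * I := by
        simp only [map_add, map_neg, map_mul, conj_ofReal, conj_I]; ring
      have e2 : 1 - 2 * (-A + t * I : ℂ).re = 1 + 2 * A := by simp
      rw [e, e2]
      gcongr
      refine (exists_norm_vertical_le_tsum ha (by linarith) t).trans ?_
      refine Summable.tsum_le_tsum (fun n => LSeries.norm_term_le_of_re_le_re a ?_ n) ?_ hsum2.norm
      · simp
        linarith
      · exact ((ha (1 + A) (by simp; linarith)).LSeriesSummable).norm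
    have hb := fun (T : ℝ) (hT : 1 ≤ T) =>
      norm_coeff_le hF.hasFiniteOrderInStrips hd ha (by linarith) hle hN0 hT
    simp only [pow_zero, gaussianMoment_zero, mul_one] at hb
    have hsq : Tendsto (fun T : ℝ => T ^ 2) atTop atTop := tendsto_pow_atTop two_ne_zero
    have l1 : Tendsto (fun T : ℝ => Real.exp (-(T ^ 2 / (8 * (N : ℝ) ^ 2)))) atTop (𝓝 0) :=
      Real.tendsto_exp_neg_atTop_nhds_zero.comp (hsq.atTop_div_const (by positivity))
    have l2 : Tendsto (fun T : ℝ => Real.exp ((A + 2) ^ 2 / (2 * T ^ 2))) atTop (𝓝 1) := by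
      have := (hsq.const_mul_atTop (show (0 : ℝ) < 2 by norm_num)).const_div_atTop ((A + 2) ^ 2)
      have h := (Real.continuous_exp.tendsto 0).comp this
      rwa [Real.exp_zero] at h
    have l3 := ((l1.const_mul ((N : ℝ) ^ 2)).mul_const S).add
      (l2.const_mul (γ.Q ^ (1 + 2 * A) * S * (N : ℝ) ^ (-A)))
    have l4 := ge_of_tendsto l3 (by
      filter_upwards [eventually_ge_atTop 1] with T hT using hb T hT)
    refine l4.trans (le_of_eq ?_)
    have e1 : γ.Q ^ (1 + 2 * A) = γ.Q ^ 3 * (γ.Q ^ 2) ^ j := by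
      rw [← pow_mul, ← pow_add, ← Real.rpow_natCast, hA]
      congr 1
      push_cast
      ring
    have e2 : (N : ℝ) ^ (-A) = ((N : ℝ) * N ^ j)⁻¹ := by
      rw [Real.rpow_neg hNr.le, ← pow_succ', ← Real.rpow_natCast, hA]
      push_cast
      rfl
    rw [e1, e2, div_pow]
    field_simp
    ring
  have hlim : Tendsto (fun j : ℕ => γ.Q ^ 3 * S / N * (γ.Q ^ 2 / N) ^ j) atTop (𝓝 0) := by
    have := (tendsto_pow_atTop_nhds_zero_of_lt_one (by positivity : 0 ≤ γ.Q ^ 2 / N)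
      ((div_lt_one hNr).2 hN)).const_mul (γ.Q ^ 3 * S / N)
    simpa using this
  exact norm_le_zero_iff.1 (ge_of_tendsto' hlim hstep)

/-! ### The Euler product of a Dirichlet polynomial, and Liouville's theorem -/

theorem abscissaOfAbsConv_le_one {a : ℕ → ℂ}
    (ha : ∀ s : ℂ, 1 < s.re → ∃ L, LSeriesHasSum a s L) : LSeries.abscissaOfAbsConv a ≤ 1 := by
  refine LSeries.abscissaOfAbsConv_le_of_forall_lt_LSeriesSummable (x := 1) fun y hy => ?_
  obtain ⟨L, hL⟩ := ha y (by simpa)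
  exact hL.LSeriesSummable

/-- The coefficients of a Dirichlet series and of its logarithm are related by
`a log = a * (b log)`. -/
theorem logMul_eq_convolution {F : ℂ → ℂ} {a b : ℕ → ℂ}
    (ha : ∀ s : ℂ, 1 < s.re → LSeriesHasSum a s (F s))
    (hb : ∀ s : ℂ, 1 < s.re → ∃ L : ℂ, LSeriesHasSum b s L ∧ exp L = F s) {n : ℕ} (hn : n ≠ 0) :
    LSeries.logMul a n = LSeries.convolution a (LSeries.logMul b) n := by
  have ha1 : LSeries.abscissaOfAbsConv a ≤ 1 :=
    abscissaOfAbsConv_le_one fun s hs => ⟨_, ha s hs⟩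
  have hb1 : LSeries.abscissaOfAbsConv b ≤ 1 :=
    abscissaOfAbsConv_le_one fun s hs => (hb s hs).imp fun _ h => h.1
  have hlt : ∀ s : ℂ, 1 < s.re → (1 : EReal) < s.re := fun s hs => by exact_mod_cast hs
  have hexp : ∀ s : ℂ, 1 < s.re → LSeries a s = exp (LSeries b s) := by
    intro s hs
    obtain ⟨L, hL, hLF⟩ := hb s hs
    rw [(ha s hs).LSeries_eq, hL.LSeries_eq, hLF]
  have hsumb : ∀ s : ℂ, 1 < s.re → LSeriesSummable (LSeries.logMul b) s := fun s hs =>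
    LSeriesSummable_logMul_of_lt_re (hb1.trans_lt (hlt s hs))
  have hprod : ∀ s : ℂ, 1 < s.re → LSeriesHasSum (LSeries.convolution a (LSeries.logMul b)) s
      (LSeries (LSeries.logMul a) s) := by
    intro s hs
    have d1 := LSeries_hasDerivAt (ha1.trans_lt (hlt s hs))
    have d2 := (LSeries_hasDerivAt (hb1.trans_lt (hlt s hs))).cexp
    have hev : LSeries a =ᶠ[𝓝 s] fun s => exp (LSeries b s) := by
      filter_upwards [(isOpen_lt continuous_const continuous_re).mem_nhds hs] with z hz
        using hexp z hz
    have h := d1.unique (d2.congr_of_eventuallyEq hev)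
    rw [← hexp s hs, mul_neg, neg_inj] at h
    rw [h]
    exact (ha s hs).LSeriesSummable.LSeriesHasSum.convolution (hsumb s hs).LSeriesHasSum
  refine LSeries.eq_of_LSeries_eventually_eq ?_ ?_ ?_ hn
  · rw [LSeries.abscissaOfAbsConv_logMul]
    exact ha1.trans_lt (EReal.coe_lt_top 1)
  · exact (abscissaOfAbsConv_le_one fun s hs => ⟨_, hprod s hs⟩).trans_lt
      (EReal.coe_lt_top 1)
  · filter_upwards [eventually_gt_atTop 1] with x hx
    exact (hprod x (by simpa)).LSeries_eq.symm

/-- For a prime `p ≥ P`, compare coefficients of `a log = a * (b log)` at `p^k`: every `a (p^i)`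
with `i ≥ 1` vanishes, leaving `0 = b (p^k) log (p^k)`. -/
theorem mem_smoothNumbers_of_eulerCoeff_ne_zero {F : ℂ → ℂ} {a b : ℕ → ℂ} (ha1 : a 1 = 1)
    (ha : ∀ s : ℂ, 1 < s.re → LSeriesHasSum a s (F s))
    (hb : ∀ s : ℂ, 1 < s.re → ∃ L : ℂ, LSeriesHasSum b s L ∧ exp L = F s)
    (hpp : ∀ n, ¬ IsPrimePow n → b n = 0) {P : ℕ} (hP : ∀ n, P ≤ n → a n = 0) {n : ℕ}
    (hn : b n ≠ 0) : n ∈ P.smoothNumbers := by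
  have hpow : IsPrimePow n := by
    by_contra h
    exact hn (hpp n h)
  obtain ⟨p, k, hp, hk, rfl⟩ := (isPrimePow_nat_iff n).1 hpow
  rw [Nat.mem_smoothNumbers']
  intro q hq hqn
  rw [(Nat.prime_dvd_prime_iff_eq hq hp).1 (hq.dvd_of_dvd_pow hqn)]
  by_contra! hpP
  have hpk : p ≤ p ^ k := Nat.le_self_pow hk.ne' p
  have hn1 : 1 < p ^ k := hp.one_lt.trans_le hpk
  have h := logMul_eq_convolution ha hb (pow_pos hp.pos k).ne'
  rw [LSeries.convolution_def, LSeries.logMul, hP _ (hpP.trans hpk), mul_zero] at h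
  beta_reduce at h
  rw [Finset.sum_eq_single (1, p ^ k), ha1, one_mul, LSeries.logMul] at h
  · have hlog : Complex.log ((p ^ k : ℕ) : ℂ) ≠ 0 := by
      rw [← natCast_log]
      exact_mod_cast (Real.log_pos (by exact_mod_cast hn1)).ne'
    exact hn ((mul_eq_zero.1 h.symm).resolve_left hlog)
  · rintro ⟨d, e⟩ hde hne
    rw [Nat.mem_divisorsAntidiagonal] at hde
    obtain ⟨i, hi, rfl⟩ := (Nat.dvd_prime_pow hp).1 (Dvd.intro _ hde.1)
    have hi0 : i ≠ 0 := by
      rintro rfl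
      simp at hde
      simp [hde] at hne
    rw [hP _ (hpP.trans (Nat.le_self_pow hi0 p)), zero_mul]
  · intro h
    simp [hp.ne_zero] at h

theorem summable_indicator_smoothNumbers_rpow (P : ℕ) {η : ℝ} (hη : 0 < η) :
    Summable ((P.smoothNumbers).indicator fun n : ℕ => (n : ℝ) ^ (-η)) := by
  let f : ℕ →* ℝ :=
    { toFun := fun n => (n : ℝ) ^ (-η)
      map_one' := by simp
      map_mul' := fun m n => by
        rw [Nat.cast_mul, Real.mul_rpow m.cast_nonneg n.cast_nonneg] }
  have hf : ∀ {p : ℕ}, p.Prime → ‖f p‖ < 1 := by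
    intro p hp
    change ‖(p : ℝ) ^ (-η)‖ < 1
    rw [Real.norm_of_nonneg (by positivity)]
    exact Real.rpow_lt_one_of_one_lt_of_neg (by exact_mod_cast hp.one_lt) (by linarith)
  have h := (EulerProduct.summable_and_hasSum_smoothNumbers_prod_primesBelow_geometric hf P).1
  exact summable_subtype_iff_indicator.1 h.of_norm

/-- Sums of `n^(-η)` over integers with all prime factors below `P` converge for every `η > 0`,
being finite products of geometric series; so the bound `n^θ` gives convergence already for `Re s >
θ`. -/
theorem LSeriesSummable_of_support_smoothNumbers {b : ℕ → ℂ} {P : ℕ} {θ : ℝ}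
    (hb : b =O[atTop] fun n : ℕ => (n : ℝ) ^ θ) (hP : ∀ n, b n ≠ 0 → n ∈ P.smoothNumbers) {s : ℂ}
    (hs : θ < s.re) : LSeriesSummable b s := by
  obtain ⟨C, hC⟩ := hb.bound
  refine summable_of_isBigO_nat
    (summable_indicator_smoothNumbers_rpow P (show 0 < s.re - θ by linarith))
    (IsBigO.of_bound C ?_)
  filter_upwards [hC, eventually_gt_atTop 0] with n hn hn0
  have hn' : (0 : ℝ) < n := by exact_mod_cast hn0
  rw [LSeries.norm_term_eq, if_neg hn0.ne']
  by_cases hbn : b n = 0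
  · rw [hbn, norm_zero, zero_div]
    rw [hbn, norm_zero] at hn
    have hC0 : 0 ≤ C := by
      by_contra! h
      have : 0 < ‖(n : ℝ) ^ θ‖ := norm_pos_iff.2 (Real.rpow_pos_of_pos hn' _).ne'
      nlinarith
    positivity
  · rw [Set.indicator_of_mem (hP n hbn), div_le_iff₀ (by positivity),
      Real.norm_of_nonneg (by positivity), mul_assoc, ← Real.rpow_add hn']
    refine hn.trans (le_of_eq ?_)
    rw [Real.norm_of_nonneg (by positivity)]
    congr 2
    ring

theorem exp_LSeries_eq_of_summable {F : ℂ → ℂ} (hd : Differentiable ℂ F) {b : ℕ → ℂ} {θ : ℝ}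
    (hsum : ∀ s : ℂ, θ < s.re → LSeriesSummable b s)
    (hb : ∀ s : ℂ, 1 < s.re → ∃ L : ℂ, LSeriesHasSum b s L ∧ exp L = F s) {s : ℂ}
    (hs : θ < s.re) : exp (LSeries b s) = F s := by
  have habs : LSeries.abscissaOfAbsConv b ≤ θ :=
    LSeries.abscissaOfAbsConv_le_of_forall_lt_LSeriesSummable fun y hy => hsum y (by simpa)
  have hL : AnalyticOnNhd ℂ (fun s => exp (LSeries b s)) {s : ℂ | θ < s.re} := fun z hz =>
    (LSeries_analyticOnNhd b z (habs.trans_lt (by exact_mod_cast hz))).cexp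
  have hFa : AnalyticOnNhd ℂ F {s : ℂ | θ < s.re} := fun z _ => hd.analyticAt z
  have h2 : (((max θ 1 + 1 : ℝ)) : ℂ) ∈ {s : ℂ | θ < s.re} := by
    have := le_max_left θ 1
    simp only [Set.mem_ofPred_eq, ofReal_re]
    linarith
  refine hL.eqOn_of_preconnected_of_eventuallyEq hFa (convex_halfSpace_re_gt θ).isPreconnected
    h2 ?_ hs
  have : {s : ℂ | 1 < s.re} ∈ 𝓝 (((max θ 1 + 1 : ℝ)) : ℂ) := by
    refine (isOpen_lt continuous_const continuous_re).mem_nhds ?_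
    have := le_max_right θ 1
    simp only [Set.mem_ofPred_eq, ofReal_re]
    linarith
  filter_upwards [this] with z hz
  obtain ⟨L, hL, hLF⟩ := hb z hz
  rw [hL.LSeries_eq, hLF]

theorem GammaFactor.IsAdmissible.eq_one_of_k_eq_zero {γ : GammaFactor} {F : ℂ → ℂ}
    (hF : F ∈ SelbergClass) (hγ : γ.IsAdmissible F) (hk : γ.k = 0) : F = fun _ => 1 := by
  obtain ⟨hF1, ⟨a, ha1, -, ha⟩, -, b, hpp, ⟨θ, hθ, hbO⟩, hb⟩ := hF
  have hd := hγ.differentiable_of_k_eq_zero hF1 hk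
  have hQ0 := γ.Q_pos
  -- Otherwise `Q^2 < 1` would force the coefficient `a 1 = 1` to vanish.
  have hQ : 1 ≤ γ.Q := by
    by_contra! h
    have h0 : a 1 = 0 := coeff_eq_zero_of_sq_lt hF1 hγ hk ha (by push_cast; nlinarith)
    simp [ha1] at h0
  obtain ⟨P, hP⟩ := exists_nat_gt (γ.Q ^ 2)
  have hPa : ∀ n, P ≤ n → a n = 0 := fun n hn =>
    coeff_eq_zero_of_sq_lt hF1 hγ hk ha (hP.trans_le (by exact_mod_cast hn))
  have hsum : ∀ s : ℂ, θ < s.re → LSeriesSummable b s := fun s hs =>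
    LSeriesSummable_of_support_smoothNumbers hbO
      (fun n hn => mem_smoothNumbers_of_eulerCoeff_ne_zero ha1 ha hb hpp hPa hn) hs
  obtain ⟨σ, hσ1, hσ2⟩ := exists_between hθ
  have hsumσ : LSeriesSummable b σ := hsum σ (by simpa)
  set M := ∑' n, ‖LSeries.term b σ n‖ with hM
  have hright : ∀ s : ℂ, σ ≤ s.re → F s ≠ 0 ∧ ‖(F s)⁻¹‖ ≤ Real.exp M := by
    intro s hs
    have hsθ : θ < s.re := by linarith
    rw [← exp_LSeries_eq_of_summable hd hsum hb hsθ]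
    refine ⟨exp_ne_zero _, ?_⟩
    rw [← exp_neg, norm_exp, Real.exp_le_exp]
    refine (re_le_norm _).trans ?_
    rw [norm_neg, hM]
    refine (norm_tsum_le_tsum_norm (hsum s hsθ).norm).trans ?_
    exact Summable.tsum_le_tsum (fun n => LSeries.norm_term_le_of_re_le_re b (by simpa) n)
      (hsum s hsθ).norm hsumσ.norm
  have hall : ∀ s : ℂ, F s ≠ 0 ∧ ‖(F s)⁻¹‖ ≤ Real.exp M := by
    intro s
    rcases le_or_gt σ s.re with hs | hs
    · exact hright s hs
    -- Since `Re s < σ < 1/2`, the reflected point lies to the right of `σ`, and `Q^(1 - 2 Re s) ≥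
    -- 1` makes `|F s|` at least its value there.
    have hfe := hγ.norm_functional_equation hd hk s
    obtain ⟨h1, h2⟩ := hright (1 - starRingEnd ℂ s) (by simp; linarith)
    have hQs : 1 ≤ γ.Q ^ (1 - 2 * s.re) := Real.one_le_rpow hQ (by linarith)
    have hpos : 0 < ‖F (1 - starRingEnd ℂ s)‖ := norm_pos_iff.2 h1
    have hle : ‖F (1 - starRingEnd ℂ s)‖ ≤ ‖F s‖ := by
      rw [hfe]
      exact le_mul_of_one_le_left hpos.le hQs
    refine ⟨norm_pos_iff.1 (hpos.trans_le hle), le_trans ?_ h2⟩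
    rw [norm_inv, norm_inv]
    exact inv_anti₀ hpos hle
  have hinv : Differentiable ℂ fun s => (F s)⁻¹ := hd.inv fun s => (hall s).1
  have hbdd : Bornology.IsBounded (Set.range fun s => (F s)⁻¹) := by
    refine (Metric.isBounded_closedBall (x := (0 : ℂ)) (r := Real.exp M)).subset ?_
    rintro _ ⟨s, rfl⟩
    simpa using (hall s).2
  have hconst : ∀ s, F s = F 0 := fun s =>
    inv_injective (hinv.apply_eq_apply_of_bounded hbdd s 0)
  have ha_abs : LSeries.abscissaOfAbsConv a < ⊤ :=
    (abscissaOfAbsConv_le_one fun s hs => ⟨_, ha s hs⟩).trans_lt (EReal.coe_lt_top 1)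
  have hlim := LSeries.tendsto_atTop ha_abs
  rw [ha1] at hlim
  -- The constant is read off as the limit of the series along the positive reals, which is `a 1`.
  have hF0 : F 0 = 1 := by
    refine tendsto_nhds_unique (tendsto_const_nhds.congr' ?_) hlim
    filter_upwards [eventually_gt_atTop 1] with x hx
    rw [(ha x (by simpa)).LSeries_eq, hconst x]
  funext s
  rw [hconst, hF0]

/-! ### The constant function `1` belongs to the class, with degree `0` -/

/-- The trivial gamma factor `γ(s) = 1`. -/
def GammaFactor.trivial : GammaFactor where
  k := 0
  ε := 1
  Q := 1
  w := fun _ => 1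
  μ := fun _ => 0
  norm_ε := norm_one
  Q_pos := one_pos
  w_pos := fun _ => one_pos
  re_μ_nonneg := fun _ => le_rfl

theorem GammaFactor.trivial_isAdmissible_one : GammaFactor.trivial.IsAdmissible fun _ => 1 := by
  intro s _ _ _ _
  have : IsEmpty (Fin GammaFactor.trivial.k) := inferInstanceAs (IsEmpty (Fin 0))
  rw [GammaFactor.eval, GammaFactor.eval, Finset.univ_eq_empty, Finset.prod_empty,
    Finset.prod_empty]
  simp [GammaFactor.trivial]

theorem GammaFactor.trivial_degree : GammaFactor.trivial.degree = 0 := by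
  have : IsEmpty (Fin GammaFactor.trivial.k) := inferInstanceAs (IsEmpty (Fin 0))
  rw [GammaFactor.degree, Finset.univ_eq_empty, Finset.sum_empty, mul_zero]

theorem one_mem_SelbergClass : (fun _ => 1) ∈ SelbergClass := by
  refine ⟨⟨⟨0, fun _ => 1, ⟨differentiable_const _, 1, ?_⟩, by simp⟩, Or.inl continuousAt_const⟩,
    ⟨LSeries.delta, by simp [LSeries.delta], ?_, fun s _ => ?_⟩,
    ⟨_, GammaFactor.trivial_isAdmissible_one⟩, 0, fun _ _ => rfl, ⟨0, by norm_num, ?_⟩,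
    fun s _ => ⟨0, ?_, exp_zero⟩⟩
  · refine IsBigO.of_bound 1 (Eventually.of_forall fun s => ?_)
    rw [norm_one, one_mul, Real.norm_of_nonneg (Real.exp_pos _).le]
    exact Real.one_le_exp (by positivity)
  · intro δ _
    refine IsBigO.of_bound 1 ?_
    filter_upwards [eventually_gt_atTop 1] with n hn
    simp only [LSeries.delta, if_neg hn.ne', norm_zero]
    positivity
  · have := hasSum_ite_eq 1 (1 : ℂ)
    rw [LSeriesHasSum, show LSeries.term LSeries.delta s = fun n => if n = 1 then 1 else 0 from
      funext (LSeries.term_delta s)]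
    exact this
  · exact isBigO_zero _ _
  · have : LSeries.term 0 s = fun _ => 0 := by funext n; simp [LSeries.term_def]
    rw [LSeriesHasSum, this]
    exact hasSum_zero

end SelbergDegree

theorem theorem3p1 :
    (∀ F ∈ SelbergDegree.SelbergClass,
      F = (fun _ => 1) ∨
        ∀ γ : SelbergDegree.GammaFactor, γ.IsAdmissible F → 1 ≤ γ.degree) ∧
    (∀ d : ℝ, 0 < d → d < 1 → SelbergDegree.SelbergClassOfDegree d = ∅) ∧
    SelbergDegree.SelbergClassOfDegree 0 = {fun _ => 1} := by
  refine ⟨fun F hF => ?_, fun d hd0 hd1 => ?_, Set.Subset.antisymm ?_ ?_⟩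
  · by_contra! h
    obtain ⟨hne, γ, hγ, hdeg⟩ := h
    exact hne (hγ.eq_one_of_k_eq_zero hF (hγ.k_eq_zero hF hdeg))
  · refine Set.eq_empty_of_forall_notMem ?_
    rintro F ⟨hF, γ, hγ, rfl⟩
    have hk := hγ.k_eq_zero hF hd1
    have : IsEmpty (Fin γ.k) := by rw [hk]; infer_instance
    simp [SelbergDegree.GammaFactor.degree] at hd0
  · rintro F ⟨hF, γ, hγ, hdeg⟩
    exact hγ.eq_one_of_k_eq_zero hF (hγ.k_eq_zero hF (by rw [hdeg]; exact one_pos))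
  · rintro _ rfl
    exact ⟨SelbergDegree.one_mem_SelbergClass, _,
      SelbergDegree.GammaFactor.trivial_isAdmissible_one,
      SelbergDegree.GammaFactor.trivial_degree⟩
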